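/- Let $L$ be a field of characteristic $0$ and let $G$ be an affine group scheme over $L$ (for instance the Tannakian group of a neutral Tannakian category $T \simeq \mathrm{Rep}_L(G)$). Let $m \ge 0$ and let $W_1,\dots,W_{m+1}$ and $V_1,\dots,V_{m+1}$ be representations of $G$ on $2$-dimensional $L$-vector spaces. Let $P_i=\mathrm{im}(G\to \mathrm{Aut}(V_i))$ and $Q_i=\mathrm{im}(G\to\mathrm{Aut}(W_i))$ be the Tannakian groups of $V_i$ and $W_i$, regarded as closed subgroup schemes of $GL(2)$ through a choice of bases of the $V_i$ and the $W_i$. Suppose that $P_i=SL(2)$ for each $i$, that the homomorphism $G\to\prod_{i=1}^{m+1}P_i$ is surjective (its schematic image is the whole product), and that $$F: W_1\otimes\cdots\otimes W_{m+1}\longrightarrow V_1\otimes\cdots\otimes V_{m+1}$$ is an isomorphism of representations of $G$. Then: (1) For each $i$, either $Q_i=GL(2)$, or $Q_i=SL(2)\cdot\mu_k$ for some integer $k\ge 1$ (depending on $i$), where $SL(2)\cdot\mu_k\subseteq GL(2)$ denotes the image of the multiplication homomorphism $SL(2)\times\mu_k\to GL(2)$, $(x,t)\mapsto tx$. (2)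 There are a permutation $s$ of $\{1,\dots,m+1\}$, $1$-dimensional representations $L_1,\dots,L_{m+1}$ of $G$, an isomorphism $\tau$ from $\bigotimes_i L_i$ to the trivial representation $L$, and isomorphisms of representations $\phi_i: W_i\to V_{s(i)}\otimes L_i$ such that $F=\bigotimes_i\phi_i$, where $\bigotimes_i (V_{s(i)}\otimes L_i)$ is identified with $\bigotimes_i V_i$ by reordering the factors and by $\tau$. -/

import Mathlib

open scoped TensorProduct

universe u v

noncomputable section

/-! ## Distributing a tensor product over a finite family -/

namespace PiDistrib

variable {R : Type*} [Field R] {ι : Type*} (M N : ι → Type*)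
  [∀ i, AddCommGroup (M i)] [∀ i, Module R (M i)]
  [∀ i, AddCommGroup (N i)] [∀ i, Module R (N i)]

/-- The canonical map `(⨂ M i) ⊗ (⨂ N i) → ⨂ (M i ⊗ N i)`,
`(⨂ x i) ⊗ (⨂ y i) ↦ ⨂ (x i ⊗ y i)`. -/
def toPi : ((⨂[R] i, M i) ⊗[R] (⨂[R] i, N i)) →ₗ[R] ⨂[R] i, (M i ⊗[R] N i) :=
  TensorProduct.lift (PiTensorProduct.map₂ (fun i => TensorProduct.mk R (M i) (N i)))

theorem toPi_tmul (x : ∀ i, M i) (y : ∀ i, N i) :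
    toPi M N (PiTensorProduct.tprod R x ⊗ₜ[R] PiTensorProduct.tprod R y) =
      PiTensorProduct.tprod R (fun i => x i ⊗ₜ[R] y i) := by
  simp [toPi, PiTensorProduct.map₂_tprod_tprod]

variable [Finite ι]

theorem toPi_bijective : Function.Bijective (toPi (R := R) M N) := by
  let b := fun i => Module.Basis.ofVectorSpace R (M i)
  let c := fun i => Module.Basis.ofVectorSpace R (N i)
  let B := (Basis.piTensorProduct b).tensorProduct (Basis.piTensorProduct c)
  let C := Basis.piTensorProduct (fun i => (b i).tensorProduct (c i))
  let e := B.equiv C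
    { toFun := fun p i => (p.1 i, p.2 i)
      invFun := fun q => (fun i => (q i).1, fun i => (q i).2)
      left_inv := fun _ => rfl
      right_inv := fun _ => rfl }
  have h : toPi (R := R) M N = e.toLinearMap := by
    refine B.ext fun p => ?_
    obtain ⟨p, q⟩ := p
    have h1 : B (p, q) = (PiTensorProduct.tprod R fun i => b i (p i)) ⊗ₜ[R]
        (PiTensorProduct.tprod R fun i => c i (q i)) := by
      simp [B]
    have h2 : e (B (p, q)) = C fun i => (p i, q i) := by
      simp [e]
    rw [LinearEquiv.coe_coe, h2, h1, toPi_tmul]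
    simp [C]
  rw [h]
  exact e.bijective

/-- The canonical isomorphism `⨂ (M i ⊗ N i) ≃ (⨂ M i) ⊗ (⨂ N i)`. -/
def equiv : (⨂[R] i, (M i ⊗[R] N i)) ≃ₗ[R] ((⨂[R] i, M i) ⊗[R] (⨂[R] i, N i)) :=
  (LinearEquiv.ofBijective (toPi M N) (toPi_bijective M N)).symm

@[simp] theorem equiv_tprod (x : ∀ i, M i) (y : ∀ i, N i) :
    equiv M N (PiTensorProduct.tprod R (fun i => x i ⊗ₜ[R] y i)) =
      PiTensorProduct.tprod R x ⊗ₜ[R] PiTensorProduct.tprod R y := by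
  rw [← toPi_tmul, equiv, LinearEquiv.symm_apply_eq]
  rfl

variable {M N} in
theorem hom_ext {E : Type*} [AddCommGroup E] [Module R E]
    {f g : (⨂[R] i, (M i ⊗[R] N i)) →ₗ[R] E}
    (h : ∀ (x : ∀ i, M i) (y : ∀ i, N i),
      f (PiTensorProduct.tprod R (fun i => x i ⊗ₜ[R] y i)) =
        g (PiTensorProduct.tprod R (fun i => x i ⊗ₜ[R] y i))) : f = g := by
  have : f ∘ₗ toPi M N = g ∘ₗ toPi M N := by
    refine TensorProduct.ext ?_
    ext x y
    simp [toPi_tmul, h]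
  refine LinearMap.ext fun z => ?_
  obtain ⟨w, rfl⟩ := (toPi_bijective (R := R) M N).2 z
  exact LinearMap.congr_fun this w

end PiDistrib

/-! ## The category of finite-dimensional representations of an affine group scheme

The affine group scheme over the field `L` is `G = Spec H`, for a commutative Hopf algebra `H`. -/

/-- A finite-dimensional representation of the affine group scheme `G = Spec H` over `L`, that is,
a finite-dimensional right `H`-comodule; `g ∈ G(R) = Hom(H, R)` acts on `V ⊗ R` through
`v ↦ (id ⊗ g) (ρ v)`. -/
structure GRep (L : Type u) (H : Type v) [Field L] [CommRing H] [HopfAlgebra L H] where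
  carrier : Type u
  [addCommGroup : AddCommGroup carrier]
  [module : Module L carrier]
  [finite : FiniteDimensional L carrier]
  /-- the coaction `ρ` -/
  ρ : carrier →ₗ[L] carrier ⊗[L] H
  coassoc : (TensorProduct.assoc L carrier H H).toLinearMap ∘ₗ ρ.rTensor H ∘ₗ ρ =
    (Coalgebra.comul (R := L) (A := H)).lTensor carrier ∘ₗ ρ
  counit : (Coalgebra.counit (R := L) (A := H)).lTensor carrier ∘ₗ ρ =
    (TensorProduct.mk L carrier L).flip 1

namespace GRep

variable {L : Type u} {H : Type v} [Field L] [CommRing H] [HopfAlgebra L H]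

instance : CoeSort (GRep L H) (Type u) := ⟨GRep.carrier⟩
instance (V : GRep L H) : AddCommGroup V := V.addCommGroup
instance (V : GRep L H) : Module L V := V.module
instance (V : GRep L H) : FiniteDimensional L V := V.finite

/-- An isomorphism of representations. -/
structure Iso (V W : GRep L H) where
  toLinearEquiv : V ≃ₗ[L] W
  comm : W.ρ ∘ₗ toLinearEquiv.toLinearMap = toLinearEquiv.toLinearMap.rTensor H ∘ₗ V.ρ

/-- The trivial representation on `L`. -/
def trivial (L : Type u) (H : Type v) [Field L] [CommRing H] [HopfAlgebra L H] : GRep L H where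
  carrier := L
  ρ := (TensorProduct.mk L L H).flip 1
  coassoc := by
    ext
    simp [Algebra.TensorProduct.one_def]
  counit := by
    ext
    simp

/-- The map `(v ⊗ a) ⊗ (w ⊗ b) ↦ (v ⊗ w) ⊗ a b`. -/
def mulRight (V W A : Type*) [AddCommGroup V] [Module L V] [AddCommGroup W] [Module L W]
    [CommRing A] [Algebra L A] : ((V ⊗[L] A) ⊗[L] (W ⊗[L] A)) →ₗ[L] (V ⊗[L] W) ⊗[L] A :=
  (LinearMap.mul' L A).lTensor (V ⊗[L] W) ∘ₗ
    (TensorProduct.tensorTensorTensorComm L V A W A).toLinearMap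

@[simp] theorem mulRight_tmul {V W A : Type*} [AddCommGroup V] [Module L V] [AddCommGroup W]
    [Module L W] [CommRing A] [Algebra L A] (v : V) (w : W) (a b : A) :
    mulRight V W A ((v ⊗ₜ[L] a) ⊗ₜ[L] (w ⊗ₜ[L] b)) = (v ⊗ₜ[L] w) ⊗ₜ[L] (a * b) := by
  simp [mulRight]

theorem mulRight_lTensor {V W A B : Type*} [AddCommGroup V] [Module L V] [AddCommGroup W]
    [Module L W] [CommRing A] [Algebra L A] [CommRing B] [Algebra L B] (f : A →ₐ[L] B)
    (x : V ⊗[L] A) (y : W ⊗[L] A) :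
    f.toLinearMap.lTensor (V ⊗[L] W) (mulRight V W A (x ⊗ₜ[L] y)) =
      mulRight V W B (f.toLinearMap.lTensor V x ⊗ₜ[L] f.toLinearMap.lTensor W y) := by
  induction x with
  | zero => simp
  | add x x' hx hx' => simp only [TensorProduct.add_tmul, map_add, hx, hx']
  | tmul v a =>
    induction y with
    | zero => simp
    | add y y' hy hy' => simp only [TensorProduct.tmul_add, map_add, hy, hy']
    | tmul w b => simp

theorem assoc_mulRight {V W A : Type*} [AddCommGroup V] [Module L V] [AddCommGroup W]
    [Module L W] [CommRing A] [Algebra L A] (x : V ⊗[L] A) (y : W ⊗[L] A) (a b : A) :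
    TensorProduct.assoc L (V ⊗[L] W) A A (mulRight V W A (x ⊗ₜ[L] y) ⊗ₜ[L] (a * b)) =
      mulRight V W (A ⊗[L] A) (TensorProduct.assoc L V A A (x ⊗ₜ[L] a) ⊗ₜ[L]
        TensorProduct.assoc L W A A (y ⊗ₜ[L] b)) := by
  induction x with
  | zero => simp
  | add x x' hx hx' => simp only [TensorProduct.add_tmul, map_add, hx, hx']
  | tmul v c =>
    induction y with
    | zero => simp
    | add y y' hy hy' => simp only [TensorProduct.add_tmul, TensorProduct.tmul_add, map_add, hy, hy']
    | tmul w d => simp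

theorem assoc_rTensor_mulRight {V W A : Type*} [AddCommGroup V] [Module L V] [AddCommGroup W]
    [Module L W] [CommRing A] [Algebra L A] (f : V →ₗ[L] V ⊗[L] A) (g : W →ₗ[L] W ⊗[L] A)
    (x : V ⊗[L] A) (y : W ⊗[L] A) :
    TensorProduct.assoc L (V ⊗[L] W) A A ((mulRight V W A ∘ₗ TensorProduct.map f g).rTensor A
      (mulRight V W A (x ⊗ₜ[L] y))) =
      mulRight V W (A ⊗[L] A) (TensorProduct.assoc L V A A (f.rTensor A x) ⊗ₜ[L]
        TensorProduct.assoc L W A A (g.rTensor A y)) := by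
  induction x with
  | zero => simp
  | add x x' hx hx' => simp only [TensorProduct.add_tmul, map_add, hx, hx']
  | tmul v c =>
    induction y with
    | zero => simp
    | add y y' hy hy' => simp only [TensorProduct.tmul_add, map_add, hy, hy']
    | tmul w d =>
      simp only [mulRight_tmul, LinearMap.rTensor_tmul, LinearMap.comp_apply,
        TensorProduct.map_tmul, assoc_mulRight]

/-- The tensor product of two representations: `v ⊗ w ↦ ∑ (v₀ ⊗ w₀) ⊗ v₁ w₁`. -/
def tensor (V W : GRep L H) : GRep L H where
  carrier := V ⊗[L] W
  ρ := mulRight V W H ∘ₗ TensorProduct.map V.ρ W.ρ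
  coassoc := by
    refine TensorProduct.ext' fun v w => ?_
    have hV := LinearMap.congr_fun V.coassoc v
    have hW := LinearMap.congr_fun W.coassoc w
    have h := mulRight_lTensor (Bialgebra.comulAlgHom L H) (V.ρ v) (W.ρ w)
    simp only [LinearMap.comp_apply, LinearEquiv.coe_coe, Bialgebra.toLinearMap_comulAlgHom,
      TensorProduct.map_tmul] at hV hW h ⊢
    rw [h, assoc_rTensor_mulRight, hV, hW]
  counit := by
    refine TensorProduct.ext' fun v w => ?_
    have hV := LinearMap.congr_fun V.counit v
    have hW := LinearMap.congr_fun W.counit w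
    have h := mulRight_lTensor (Bialgebra.counitAlgHom L H) (V.ρ v) (W.ρ w)
    simp only [LinearMap.comp_apply, Bialgebra.toLinearMap_counitAlgHom,
      TensorProduct.map_tmul] at hV hW h ⊢
    rw [h, hV, hW]
    simp

/-- The map `⨂ (v i ⊗ a i) ↦ (⨂ v i) ⊗ ∏ a i`. -/
def piMulRight {ι : Type} [Fintype ι] (V : ι → Type*) (A : Type*) [∀ i, AddCommGroup (V i)]
    [∀ i, Module L (V i)] [CommRing A] [Algebra L A] :
    (⨂[L] i, (V i ⊗[L] A)) →ₗ[L] (⨂[L] i, V i) ⊗[L] A :=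
  (PiTensorProduct.lift (MultilinearMap.mkPiAlgebra L ι A)).lTensor (⨂[L] i, V i) ∘ₗ
    (PiDistrib.equiv V (fun _ => A)).toLinearMap

section

variable {ι : Type} [Fintype ι] {V : ι → Type*} {A B : Type*} [∀ i, AddCommGroup (V i)]
    [∀ i, Module L (V i)] [CommRing A] [Algebra L A] [CommRing B] [Algebra L B]

@[simp] theorem piMulRight_tprod (v : ∀ i, V i) (a : ι → A) :
    piMulRight V A (PiTensorProduct.tprod L fun i => v i ⊗ₜ[L] a i) =
      PiTensorProduct.tprod L v ⊗ₜ[L] ∏ i, a i := by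
  simp [piMulRight]

theorem piMulRight_lTensor (f : A →ₐ[L] B) :
    f.toLinearMap.lTensor (⨂[L] i, V i) ∘ₗ piMulRight V A =
      piMulRight V B ∘ₗ PiTensorProduct.map (fun i => f.toLinearMap.lTensor (V i)) := by
  refine PiDistrib.hom_ext fun x y => ?_
  simp [PiTensorProduct.map_tprod]

theorem assoc_piMulRight (a : ι → A) :
    (TensorProduct.assoc L (⨂[L] i, V i) A A).toLinearMap ∘ₗ
      (TensorProduct.mk L _ A).flip (∏ i, a i) ∘ₗ piMulRight V A =
    piMulRight V (A ⊗[L] A) ∘ₗ PiTensorProduct.map (fun i =>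
      (TensorProduct.assoc L (V i) A A).toLinearMap ∘ₗ (TensorProduct.mk L _ A).flip (a i)) := by
  refine PiDistrib.hom_ext fun x y => ?_
  have h : ∀ s : Finset ι, ∏ i ∈ s, (y i ⊗ₜ[L] a i) = (∏ i ∈ s, y i) ⊗ₜ[L] ∏ i ∈ s, a i := by
    classical
    intro s
    induction s using Finset.induction_on with
    | empty => simp [Algebra.TensorProduct.one_def]
    | insert i s hi ih => simp [Finset.prod_insert hi, ih]
  simp [PiTensorProduct.map_tprod, h]

theorem assoc_rTensor_piMulRight (f : ∀ i, V i →ₗ[L] V i ⊗[L] A) :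
    (TensorProduct.assoc L (⨂[L] i, V i) A A).toLinearMap ∘ₗ
      (piMulRight V A ∘ₗ PiTensorProduct.map f).rTensor A ∘ₗ piMulRight V A =
    piMulRight V (A ⊗[L] A) ∘ₗ PiTensorProduct.map (fun i =>
      (TensorProduct.assoc L (V i) A A).toLinearMap ∘ₗ (f i).rTensor A) := by
  refine PiDistrib.hom_ext fun x y => ?_
  have h := LinearMap.congr_fun (assoc_piMulRight (V := V) y)
    (PiTensorProduct.tprod L fun i => f i (x i))
  simpa [PiTensorProduct.map_tprod] using h

end

/-- The tensor product of a finite family of representations: the coaction sends `⨂ v i` to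
`∑ (⨂ (v i)₀) ⊗ ∏ (v i)₁`. -/
def piTensor {ι : Type} [Fintype ι] (V : ι → GRep L H) : GRep L H where
  carrier := ⨂[L] i, V i
  ρ := piMulRight (fun i => (V i : Type u)) H ∘ₗ PiTensorProduct.map (fun i => (V i).ρ)
  coassoc := by
    have h1 := assoc_rTensor_piMulRight (fun i => (V i).ρ)
    have h2 := piMulRight_lTensor (V := fun i => (V i : Type u)) (Bialgebra.comulAlgHom L H)
    rw [Bialgebra.toLinearMap_comulAlgHom] at h2
    rw [← LinearMap.comp_assoc, ← LinearMap.comp_assoc, ← LinearMap.comp_assoc,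
      LinearMap.comp_assoc (piMulRight _ H), h1, h2]
    simp only [LinearMap.comp_assoc, ← PiTensorProduct.map_comp, (V _).coassoc]
  counit := by
    have h2 := piMulRight_lTensor (V := fun i => (V i : Type u)) (Bialgebra.counitAlgHom L H)
    rw [Bialgebra.toLinearMap_counitAlgHom] at h2
    rw [← LinearMap.comp_assoc, h2, LinearMap.comp_assoc, ← PiTensorProduct.map_comp]
    simp only [(V _).counit]
    ext v
    simp [PiTensorProduct.map_tprod]

/-! ### Matrix coefficients -/

variable {n : ℕ}

/-- The matrix `a` over `H` with `ρ (b j) = ∑ i, b i ⊗ a i j`. -/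
def coeffMatrix (V : GRep L H) (b : Module.Basis (Fin n) L V) : Matrix (Fin n) (Fin n) H :=
  Matrix.of fun i j => TensorProduct.lid L H ((b.coord i).rTensor H (V.ρ (b j)))

theorem ρ_basis (V : GRep L H) (b : Module.Basis (Fin n) L V) (j : Fin n) :
    V.ρ (b j) = ∑ i, b i ⊗ₜ[L] V.coeffMatrix b i j := by
  have key : ∀ x : V ⊗[L] H,
      x = ∑ i, b i ⊗ₜ[L] TensorProduct.lid L H ((b.coord i).rTensor H x) := by
    intro x
    induction x with
    | zero => simp
    | add x y hx hy =>
      simp only [map_add, TensorProduct.tmul_add, Finset.sum_add_distrib]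
      rw [← hx, ← hy]
    | tmul v h =>
      conv_lhs => rw [← b.sum_repr v]
      simp only [TensorProduct.sum_tmul, LinearMap.rTensor_tmul, Module.Basis.coord_apply,
        TensorProduct.lid_tmul, TensorProduct.smul_tmul]
  exact key _

theorem counit_coeffMatrix (V : GRep L H) (b : Module.Basis (Fin n) L V) (i j : Fin n) :
    Coalgebra.counit (R := L) (V.coeffMatrix b i j) = if i = j then 1 else 0 := by
  have h := LinearMap.congr_fun V.counit (b j)
  simp only [LinearMap.comp_apply, ρ_basis V b j, map_sum, LinearMap.lTensor_tmul,
    LinearMap.flip_apply, TensorProduct.mk_apply] at h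
  have h2 := congrArg (fun x => TensorProduct.lid L L ((b.coord i).rTensor L x)) h
  simpa [Finsupp.single_apply, eq_comm] using h2

theorem comul_coeffMatrix (V : GRep L H) (b : Module.Basis (Fin n) L V) (i j : Fin n) :
    Coalgebra.comul (R := L) (V.coeffMatrix b i j) =
      ∑ k, V.coeffMatrix b i k ⊗ₜ[L] V.coeffMatrix b k j := by
  have h := LinearMap.congr_fun V.coassoc (b j)
  simp only [LinearMap.comp_apply, ρ_basis V b, map_sum, LinearMap.lTensor_tmul,
    LinearMap.rTensor_tmul, TensorProduct.sum_tmul, LinearEquiv.coe_coe,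
    TensorProduct.assoc_tmul] at h
  have h2 := congrArg (fun x => TensorProduct.lid L (H ⊗[L] H) ((b.coord i).rTensor (H ⊗[L] H) x)) h
  simp only [map_sum, LinearMap.rTensor_tmul, Module.Basis.coord_apply, Module.Basis.repr_self,
    TensorProduct.lid_tmul, Finsupp.single_apply, ite_smul, one_smul, zero_smul] at h2
  simpa using h2.symm

theorem isUnit_det_coeffMatrix (V : GRep L H) (b : Module.Basis (Fin n) L V) :
    IsUnit (V.coeffMatrix b).det := by
  have h : V.coeffMatrix b * (V.coeffMatrix b).map (HopfAlgebra.antipode L) = 1 := by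
    ext i j
    have h := HopfAlgebra.mul_antipode_lTensor_comul_apply (R := L) (V.coeffMatrix b i j)
    rw [comul_coeffMatrix, counit_coeffMatrix] at h
    simp only [map_sum, LinearMap.lTensor_tmul, LinearMap.mul'_apply] at h
    rw [Matrix.mul_apply, Matrix.one_apply]
    simp only [Matrix.map_apply]
    rw [h]
    split_ifs <;> simp
  exact Matrix.isUnit_det_of_right_inverse h

end GRep

/-! ## Coordinate rings of `GL(n)`, of `SL(n)` and of `SL(n) · μ_k ⊆ GL(n)` -/

namespace GLn

/-- The determinant of the generic matrix. -/
abbrev genericDet (L : Type u) [Field L] (n : ℕ) : MvPolynomial (Fin n × Fin n) L :=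
  (Matrix.mvPolynomialX (Fin n) (Fin n) L).det

/-- The coordinate ring `L[x i j, 1 / det]` of `GL(n)`. -/
def Coord (L : Type u) [Field L] (n : ℕ) : Type u := Localization.Away (genericDet L n)

instance (L : Type u) [Field L] (n : ℕ) : CommRing (Coord L n) :=
  inferInstanceAs (CommRing (Localization.Away (genericDet L n)))
instance (L : Type u) [Field L] (n : ℕ) : Algebra L (Coord L n) :=
  inferInstanceAs (Algebra L (Localization.Away (genericDet L n)))
instance (L : Type u) [Field L] (n : ℕ) :
    Algebra (MvPolynomial (Fin n × Fin n) L) (Coord L n) :=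
  inferInstanceAs (Algebra _ (Localization.Away (genericDet L n)))
instance (L : Type u) [Field L] (n : ℕ) :
    IsScalarTower L (MvPolynomial (Fin n × Fin n) L) (Coord L n) :=
  inferInstanceAs (IsScalarTower L _ (Localization.Away (genericDet L n)))
instance (L : Type u) [Field L] (n : ℕ) :
    IsLocalization.Away (genericDet L n) (Coord L n) :=
  inferInstanceAs (IsLocalization.Away (genericDet L n) (Localization.Away (genericDet L n)))

variable {L : Type u} [Field L] {n : ℕ}

theorem isUnit_aeval_genericDet {A : Type*} [CommRing A] [Algebra L A]
    (a : Matrix (Fin n) (Fin n) A) (ha : IsUnit a.det) :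
    IsUnit (MvPolynomial.aeval (R := L) (fun p : Fin n × Fin n => a p.1 p.2) (genericDet L n)) := by
  have := AlgHom.map_det (MvPolynomial.aeval (R := L) (fun p : Fin n × Fin n => a p.1 p.2))
    (Matrix.mvPolynomialX (Fin n) (Fin n) L)
  rw [this, Matrix.mvPolynomialX_mapMatrix_aeval]
  exact ha

/-- The `A`-point of `GL(n)` given by an invertible matrix `a` over an `L`-algebra `A`, as the
homomorphism `x i j ↦ a i j` from the coordinate ring to `A`. -/
def point {A : Type*} [CommRing A] [Algebra L A]
    (a : Matrix (Fin n) (Fin n) A) (ha : IsUnit a.det) : Coord L n →ₐ[L] A :=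
  IsLocalization.Away.liftAlgHom (genericDet L n) (isUnit_aeval_genericDet a ha)

variable (L n)

/-- The ideal of the closed subgroup scheme `SL(n)` of `GL(n)`. -/
def idealSL : Ideal (Coord L n) :=
  Ideal.span {algebraMap (MvPolynomial (Fin n × Fin n) L) (Coord L n) (genericDet L n) - 1}

/-- The coordinate ring of `SL(n)`. -/
def CoordSL : Type u := Coord L n ⧸ idealSL L n

instance : CommRing (CoordSL L n) := inferInstanceAs (CommRing (Coord L n ⧸ idealSL L n))
instance : Algebra L (CoordSL L n) := inferInstanceAs (Algebra L (Coord L n ⧸ idealSL L n))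

/-- The restriction of functions from `GL(n)` to `SL(n)`. -/
def toSL : Coord L n →ₐ[L] CoordSL L n := Ideal.Quotient.mkₐ L (idealSL L n)

/-- The coordinate ring of `μ_k` for `k ≥ 1`: the group algebra of `ℤ / k`,
isomorphic to `L[t] / (t ^ k - 1)`. -/
def CoordMu (L : Type u) [Field L] (k : ℕ) : Type u := AddMonoidAlgebra L (ZMod k)

instance (k : ℕ) : CommRing (CoordMu L k) := inferInstanceAs (CommRing (AddMonoidAlgebra L (ZMod k)))
instance (k : ℕ) : Algebra L (CoordMu L k) :=
  inferInstanceAs (Algebra L (AddMonoidAlgebra L (ZMod k)))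

/-- The generic matrix of `SL(n)`. -/
def genericSL : Matrix (Fin n) (Fin n) (CoordSL L n) :=
  Matrix.of fun i j => toSL L n
    (algebraMap (MvPolynomial (Fin n × Fin n) L) (Coord L n) (MvPolynomial.X (i, j)))

/-- The generic element `t` of `μ_k`. -/
def genericMu (k : ℕ) : CoordMu L k :=
  (AddMonoidAlgebra.single 1 1 : AddMonoidAlgebra L (ZMod k))

/-- The matrix `t x` of functions on `SL(n) × μ_k`, where `x` is the generic matrix of `SL(n)` and
`t` the generic element of `μ_k`. -/
def genericSLMu (k : ℕ) : Matrix (Fin n) (Fin n) (CoordSL L n ⊗[L] CoordMu L k) :=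
  Matrix.of fun i j => genericSL L n i j ⊗ₜ[L] genericMu L k

theorem det_genericSL : (genericSL L n).det = 1 := by
  have h : genericSL L n = (Matrix.mvPolynomialX (Fin n) (Fin n) L).map
      (((toSL L n).toRingHom.comp (algebraMap (MvPolynomial (Fin n × Fin n) L) (Coord L n)))) := by
    ext i j
    simp [genericSL]
  rw [h, ← RingHom.mapMatrix_apply, ← RingHom.map_det, ← map_one (toSL L n)]
  exact (Ideal.Quotient.eq (I := idealSL L n)).2 (Ideal.subset_span rfl)

theorem isUnit_det_genericSLMu (k : ℕ) : IsUnit (genericSLMu L n k).det := by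
  have h : genericSLMu L n k = ((1 : CoordSL L n) ⊗ₜ[L] genericMu L k) •
      (genericSL L n).map (Algebra.TensorProduct.includeLeft : _ →ₐ[L] _ ⊗[L] CoordMu L k) := by
    ext i j
    simp [genericSLMu]
  have ht : IsUnit (genericMu L k) := by
    have := (Group.isUnit (Multiplicative.ofAdd (1 : ZMod k))).map (AddMonoidAlgebra.of L (ZMod k))
    exact this
  have hdet : ((genericSL L n).map
      (Algebra.TensorProduct.includeLeft : _ →ₐ[L] _ ⊗[L] CoordMu L k)).det = 1 := by
    rw [← AlgHom.mapMatrix_apply, ← AlgHom.map_det, det_genericSL, map_one]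
  rw [h, Matrix.det_smul, hdet]
  refine IsUnit.mul (IsUnit.pow _ ?_) isUnit_one
  exact ht.map (Algebra.TensorProduct.includeRight :
    CoordMu L k →ₐ[L] CoordSL L n ⊗[L] CoordMu L k)

/-- The ideal of the closed subgroup scheme `SL(n) · μ_k` of `GL(n)`, the image of the
multiplication homomorphism `SL(n) × μ_k → GL(n)`, `(x, t) ↦ t x`. -/
def idealSLMu (k : ℕ) : Ideal (Coord L n) :=
  RingHom.ker (point (genericSLMu L n k) (isUnit_det_genericSLMu L n k))

end GLn

namespace GRep

variable {L : Type u} {H : Type v} [Field L] [CommRing H] [HopfAlgebra L H] {n : ℕ}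

/-- The homomorphism `G → Aut(V) = GL(n)` of group schemes given by a representation `V` with a
basis, as the homomorphism of coordinate rings `x i j ↦ a i j`. -/
def toGL (V : GRep L H) (b : Module.Basis (Fin n) L V) : GLn.Coord L n →ₐ[L] H :=
  GLn.point (V.coeffMatrix b) (V.isUnit_det_coeffMatrix b)

/-- The ideal of the Tannakian group of `V`, the closed subgroup scheme `im (G → Aut(V))` of
`Aut(V) = GL(n)`. -/
def imageIdeal (V : GRep L H) (b : Module.Basis (Fin n) L V) : Ideal (GLn.Coord L n) :=
  RingHom.ker (V.toGL b)

/-- The coordinate ring of the Tannakian group `im (G → Aut(V))` of `V`, as a subalgebra of `H`. -/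
def imageCoord (V : GRep L H) (b : Module.Basis (Fin n) L V) : Subalgebra L H :=
  (V.toGL b).range

/-- The homomorphism `G → ∏ i, im (G → Aut(V i))` on coordinate rings: the multiplication map
`⨂ a i ↦ ∏ a i` from the tensor product of the coordinate rings of the images to `H`. -/
def toProdImages {ι : Type} [Fintype ι] (V : ι → GRep L H)
    (b : ∀ i, Module.Basis (Fin n) L (V i)) : (⨂[L] i, (V i).imageCoord (b i)) →ₗ[L] H :=
  PiTensorProduct.lift ((MultilinearMap.mkPiAlgebra L ι H).compLinearMap
    fun i => ((V i).imageCoord (b i)).val.toLinearMap)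

/-- The homomorphism `G → ∏ i, im (G → Aut(V i))` of affine group schemes is surjective, that is,
the closed image is the whole product. -/
def JointlySurjective {ι : Type} [Fintype ι] (V : ι → GRep L H)
    (b : ∀ i, Module.Basis (Fin n) L (V i)) : Prop :=
  Function.Injective (toProdImages V b)

/-- For a permutation `s`, linear isomorphisms `φ i : W i ≃ V (s i) ⊗ N i` and a trivialization
`τ : ⨂ N i ≃ L`, the isomorphism `⨂ φ i` seen as a map `⨂ W i → ⨂ V i`, namely
`⨂ W i → ⨂ (V (s i) ⊗ N i) ≅ (⨂ V (s i)) ⊗ (⨂ N i) ≅ (⨂ V i) ⊗ L ≅ ⨂ V i`. -/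
def tensorOfFactors {ι : Type} [Fintype ι] {W V N : ι → GRep L H} (s : Equiv.Perm ι)
    (τ : (piTensor N).Iso (trivial L H)) (φ : ∀ i, (W i).Iso ((V (s i)).tensor (N i))) :
    (⨂[L] i, W i) ≃ₗ[L] ⨂[L] i, V i :=
  PiTensorProduct.congr (fun i => (φ i).toLinearEquiv) ≪≫ₗ
  PiDistrib.equiv (fun i => (V (s i) : Type u)) (fun i => (N i : Type u)) ≪≫ₗ
  TensorProduct.congr (PiTensorProduct.reindex L (fun i => (V i : Type u)) s.symm).symm
    τ.toLinearEquiv ≪≫ₗ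
  TensorProduct.rid L (⨂[L] i, V i)

end GRep

end

/-!
Write `v i` and `w i` for the matrices of coefficients of `V i` and `W i`; these are invertible
matrices over the Hopf algebra `H`. The isomorphism `F` is an invertible matrix over `L` which
intertwines the Kronecker product of the `w i` with that of the `v i`.

*Factorization of `F`.* Let `A` be the matrix algebra `End (⨂ V i)`, the tensor product of the
`2 × 2` matrix algebras of the factors. Conjugation by `F` carries the `i`-th factor of `End (⨂ W i)`
to a `4`-dimensional subalgebra `U` of `A` that is stable under conjugation by `⨂ v i`. Since the
`V i` have image `SL(2)` and are jointly surjective, the `v i` can be specialized to arbitrary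
matrices of determinant `1` over `L` (`GRep.exists_specialization`), so `U` is stable under
conjugation by `∏ SL(2, L)`, hence under commutators with the nilpotent matrix units of all the
factors. Such a subspace that contains `1` has to be one of the tensor factors of `A`
(`exists_matrixUnitPair_mem`): the representation `A` is the direct sum of the tensor products of the
adjoint representations over all subsets of the factors, whose dimensions are powers of `3`. Hence
conjugation by `F` permutes the tensor factors, and by the Skolem–Noether theorem `F` is the tensor
product of linear maps `f i` up to a permutation `s` and a scalar. Comparing the coefficients of
`⨂ (f i) (w i)` and `⨂ (v (s i)) (f i)` shows that `f i` intertwines `w i` with `χ i • v (s i)` for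
elements `χ i` of `H` with product `1` (`exists_factorization`). These are group-like because `v`
and `w` are multiplicative, and they are the representations `L i`.

*Images of the `W i`.* It remains to find the image of `χ v`, where `v` identifies the coordinate
ring `B` of `SL(2)` with a subalgebra of `H` and `χ` is a group-like element of order `k`. It factors
through the multiplication map of `SL(2) × μ_k`, with `μ_0` the multiplicative group, so the image is
`SL(2) · μ_k` as soon as the distinct powers of `χ` are linearly independent over `B`. A shortest
relation would produce a nontrivial quotient of two powers of `χ` inside `B`
(`coeff_eq_zero_of_groupLike`), but `B` has no nontrivial group-like elements, because `SL(2)` is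
generated by unipotent one-parameter groups (`GLn.eq_one_of_multiplicative`). For `k = 0` the image
is all of `GL(2)` because a generic matrix is a product of a matrix of determinant `1` and a square
root of its determinant (`GLn.idealSLMu_zero`).
-/

/-! ### Systems of `2 × 2` matrix units -/

section MatrixUnits

variable {A : Type*} [Ring A]

/-- A pair `e, f` playing the roles of the matrix units `E₀₁, E₁₀`; it is the same as a ring
homomorphism from the `2 × 2` integer matrices to `A`. -/
structure IsMatrixUnitPair (e f : A) : Prop where
  sq_left : e * e = 0
  sq_right : f * f = 0
  add_eq_one : e * f + f * e = 1

namespace IsMatrixUnitPair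

variable {e f : A} (h : IsMatrixUnitPair e f)
include h

theorem symm : IsMatrixUnitPair f e :=
  ⟨h.sq_right, h.sq_left, by rw [add_comm, h.add_eq_one]⟩

theorem left_right_left : e * f * e = e := by
  have := congrArg (e * ·) h.add_eq_one
  simpa [mul_add, ← mul_assoc, h.sq_left] using this

theorem right_left_right : f * e * f = f := h.symm.left_right_left

theorem eq_zero_of_mul_eq_zero {y : A} (hf : Commute f y) (hy : e * y = 0) : y = 0 := by
  calc y = (e * f + f * e) * y := by rw [h.add_eq_one, one_mul]
    _ = e * (f * y) + f * (e * y) := by noncomm_ring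
    _ = 0 := by rw [hf.eq, ← mul_assoc, hy]; simp

/-- The entry of `x` in the lower left corner, an element of the centralizer of the matrix units. -/
theorem commute_corner (x : A) :
    Commute e (e * x * e * f + f * (e * x * e)) ∧ Commute f (e * x * e * f + f * (e * x * e)) := by
  have h1 := h.left_right_left
  have h2 := h.sq_left
  have h3 := h.sq_right
  constructor
  · calc e * (e * x * e * f + f * (e * x * e))
        = (e * e) * x * e * f + (e * f * e) * x * e := by noncomm_ring
      _ = e * x * (e * f * e) + f * (e * x * (e * e)) := by rw [h1, h2]; simp
      _ = _ := by noncomm_ring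
  · calc f * (e * x * e * f + f * (e * x * e))
        = f * e * x * e * f + (f * f) * (e * x * e) := by noncomm_ring
      _ = f * e * x * e * f + (e * x * e) * (f * f) := by rw [h3]; simp
      _ = _ := by noncomm_ring

theorem mul_corner (x : A) : e * (e * x * e * f + f * (e * x * e)) = e * x * e := by
  calc e * (e * x * e * f + f * (e * x * e))
        = (e * e) * x * e * f + (e * f * e) * x * e := by noncomm_ring
      _ = e * x * e := by rw [h.left_right_left, h.sq_left]; simp

theorem commute_of_corner_eq_zero {x : A} (h0 : e * x * e = 0)
    (h1 : e * f * x * e = e * x * f * e) (h2 : e * f * x * f * e = 0) :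
    Commute e x ∧ Commute f x := by
  have hex : e * x = e * x * f * e := by
    calc e * x = e * x * (e * f + f * e) := by rw [h.add_eq_one, mul_one]
      _ = (e * x * e) * f + e * x * f * e := by noncomm_ring
      _ = _ := by rw [h0, zero_mul, zero_add]
  have hxe : x * e = e * f * x * e := by
    calc x * e = (e * f + f * e) * (x * e) := by rw [h.add_eq_one, one_mul]
      _ = e * f * x * e + f * (e * x * e) := by noncomm_ring
      _ = _ := by rw [h0, mul_zero, add_zero]
  have hfx : f * x = f * (e * f * x * e) * f := by
    calc f * x = (f * e * f) * x * (e * f + f * e) := by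
          rw [h.add_eq_one, mul_one, h.right_left_right]
      _ = f * (e * f * x * e) * f + f * (e * f * x * f * e) := by noncomm_ring
      _ = _ := by rw [h2, mul_zero, add_zero]
  have hxf : x * f = f * (e * x * f * e) * f := by
    calc x * f = (e * f + f * e) * x * (f * e * f) := by
          rw [h.add_eq_one, one_mul, h.right_left_right]
      _ = (e * f * x * f * e) * f + f * (e * x * f * e) * f := by noncomm_ring
      _ = _ := by rw [h2, zero_mul, zero_add]
  exact ⟨by rw [Commute, SemiconjBy, hex, hxe, h1], by rw [Commute, SemiconjBy, hfx, hxf, h1]⟩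

variable {L : Type*} [Field L] [CharZero L] [Algebra L A]

/-- A subspace stable under the adjoint action of `e` and `f` which does not centralize them
contains the elements `e y`, `h y`, `f y` for some `y ≠ 0` in the centralizer, where `h = [e, f]`. -/
theorem exists_corner_ne_zero (U : Submodule L A)
    (hUe : ∀ x ∈ U, e * x - x * e ∈ U) (hUf : ∀ x ∈ U, f * x - x * f ∈ U)
    (hU : ∃ x ∈ U, ¬ (Commute e x ∧ Commute f x)) :
    ∃ y, y ≠ 0 ∧ Commute e y ∧ Commute f y ∧ e * y ∈ U ∧ (e * f - f * e) * y ∈ U ∧ f * y ∈ U := by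
  obtain ⟨x, hx, hx0⟩ : ∃ x ∈ U, e * x * e ≠ 0 := by
    by_contra! h0
    obtain ⟨x, hx, hc⟩ := hU
    refine hc (h.commute_of_corner_eq_zero (h0 x hx) ?_ ?_)
    · have := h0 _ (hUf x hx)
      rw [← sub_eq_zero, ← this]; noncomm_ring
    · have h1 := h0 _ (hUf _ (hUf x hx))
      have h2 : e * (f * (f * x - x * f) - (f * x - x * f) * f) * e =
          e * (f * f) * x * e + e * x * (f * f) * e - (2 : L) • (e * f * x * f * e) := by
        rw [two_smul]; noncomm_ring
      rw [h2, h.sq_right] at h1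
      simpa using h1
  obtain ⟨he, hf⟩ := h.commute_corner x
  have hm := h.mul_corner x
  set y := e * x * e * f + f * (e * x * e) with hy
  have hey : e * y ∈ U := by
    have h1 := hUe _ (hUe x hx)
    have h2 : e * (e * x - x * e) - (e * x - x * e) * e =
        (e * e) * x + x * (e * e) - (2 : L) • (e * x * e) := by
      rw [two_smul]; noncomm_ring
    rw [h2, h.sq_left, zero_mul, mul_zero, add_zero, zero_sub, U.neg_mem_iff,
      U.smul_mem_iff two_ne_zero] at h1
    rwa [hm]
  have hhy : (e * f - f * e) * y ∈ U := by
    have h1 := U.neg_mem (hUf _ hey)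
    convert h1 using 1
    rw [mul_assoc, ← hf.eq]; noncomm_ring
  refine ⟨y, fun h0 => hx0 (by rw [← hm, h0, mul_zero]), he, hf, hey, hhy, ?_⟩
  have h1 := hUf _ hhy
  have h2 : f * ((e * f - f * e) * y) - (e * f - f * e) * y * f = (2 : L) • (f * y) := by
    calc _ = f * e * f * y - f * f * e * y - (e * f - f * e) * (y * f) := by noncomm_ring
      _ = f * e * f * y - f * f * e * y - (e * (f * f) - f * e * f) * y := by
        rw [← hf.eq]; noncomm_ring
      _ = _ := by rw [h.right_left_right, h.sq_right, two_smul]; noncomm_ring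
  rwa [h2, U.smul_mem_iff two_ne_zero] at h1

/-- If `y ≠ 0` commutes with `e` and `f` then `1, e y, h y, f y` are linearly independent. -/
theorem linearIndependent_of_commute {y : A} (hy : y ≠ 0) (he : Commute e y) (hf : Commute f y) :
    LinearIndependent L ![1, e * y, (e * f - f * e) * y, f * y] := by
  rw [Fintype.linearIndependent_iff]
  intro g hg
  have hey : e * y ≠ 0 := fun h0 => hy (h.eq_zero_of_mul_eq_zero hf h0)
  have hfy : f * y ≠ 0 := fun h0 => hy (h.symm.eq_zero_of_mul_eq_zero he h0)
  have h1 := h.sq_left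
  have h2 := h.sq_right
  have h3 := h.left_right_left
  have h4 := h.right_left_right
  simp only [Fin.sum_univ_four, Matrix.cons_val] at hg
  have g1 : g 1 = 0 := by
    have : f * (g 0 • 1 + g 1 • (e * y) + g 2 • ((e * f - f * e) * y) + g 3 • (f * y)) * f =
        g 1 • (f * y) := by
      calc _ = g 0 • (f * f) + g 1 • (f * e * (y * f)) + g 2 • (f * (e * f - f * e) * (y * f)) +
            g 3 • (f * f * y * f) := by
            simp only [mul_add, add_mul, mul_smul_comm, smul_mul_assoc, mul_one, mul_assoc]
        _ = g 0 • (f * f) + g 1 • ((f * e * f) * y) +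
            g 2 • ((f * e * (f * f) - f * f * e * f) * y) + g 3 • (f * f * y * f) := by
            rw [← hf.eq]; simp only [mul_sub, sub_mul, mul_assoc]
        _ = _ := by rw [h4, h2]; simp
    rw [hg] at this
    simpa [hfy] using this.symm
  have g3 : g 3 = 0 := by
    have : e * (g 0 • 1 + g 1 • (e * y) + g 2 • ((e * f - f * e) * y) + g 3 • (f * y)) * e =
        g 3 • (e * y) := by
      calc _ = g 0 • (e * e) + g 1 • (e * e * (y * e)) + g 2 • (e * (e * f - f * e) * (y * e)) +
            g 3 • (e * f * (y * e)) := by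
            simp only [mul_add, add_mul, mul_smul_comm, smul_mul_assoc, mul_one, mul_assoc]
        _ = g 0 • (e * e) + g 1 • (e * e * (y * e)) +
            g 2 • ((e * e * f * e - e * f * (e * e)) * y) + g 3 • ((e * f * e) * y) := by
            rw [← he.eq]; simp only [mul_sub, sub_mul, mul_assoc]
        _ = _ := by rw [h3, h1]; simp
    rw [hg] at this
    simpa [hey] using this.symm
  rw [g1, g3, zero_smul, zero_smul, add_zero, add_zero] at hg
  have k1 : g 0 • e + g 2 • (e * y) = 0 := by
    have : (g 0 • 1 + g 2 • ((e * f - f * e) * y)) * e = 0 := by rw [hg, zero_mul]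
    rw [← this]
    calc _ = g 0 • e + g 2 • ((e * f * e - f * (e * e)) * y) := by rw [h1, h3]; simp
      _ = g 0 • e + g 2 • ((e * f - f * e) * (e * y)) := by
        simp only [sub_mul, mul_assoc]
      _ = _ := by rw [he.eq]; simp only [add_mul, smul_mul_assoc, one_mul, mul_assoc]
  have k2 : g 0 • e - g 2 • (e * y) = 0 := by
    have : e * (g 0 • 1 + g 2 • ((e * f - f * e) * y)) = 0 := by rw [hg, mul_zero]
    rw [← this]
    calc _ = g 0 • e + g 2 • ((e * e * f - e * f * e) * y) := by rw [h1, h3]; simp [sub_eq_add_neg]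
      _ = _ := by simp only [mul_add, mul_smul_comm, mul_one, mul_sub, sub_mul, mul_assoc]
  have g2 : g 2 = 0 := by
    have : (2 : L) • (g 2 • (e * y)) = 0 := by
      rw [two_smul]
      calc _ = (g 0 • e + g 2 • (e * y)) - (g 0 • e - g 2 • (e * y)) := by abel
        _ = 0 := by rw [k1, k2, sub_zero]
    simpa [hey] using this
  have g0 : g 0 = 0 := by
    have he0 : e ≠ 0 := fun h0 => hey (by rw [h0, zero_mul])
    simpa [g2, he0] using k1
  intro i
  fin_cases i <;> assumption

end IsMatrixUnitPair

/-- Let `e k, f k` be commuting pairs of matrix units with only scalars as common centralizer.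
A `4`-dimensional subspace that contains `1` and is stable under the adjoint action of all `e k`
and `f k` contains the four matrix units of one of the pairs. For the action of `∏ SL(2)` by
conjugation on a tensor product of matrix algebras this says that the only nontrivial
subrepresentations of dimension `3` are the adjoint representations of the factors. -/
theorem exists_matrixUnitPair_mem {L : Type*} [Field L] [CharZero L] [Algebra L A] {κ : Type*}
    (e f : κ → A) (h : ∀ k, IsMatrixUnitPair (e k) (f k))
    (hcomm : ∀ j k, j ≠ k → Commute (e j) (e k) ∧ Commute (e j) (f k) ∧ Commute (f j) (e k) ∧
      Commute (f j) (f k))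
    (hcent : ∀ x, (∀ k, Commute (e k) x ∧ Commute (f k) x) → ∃ c : L, x = algebraMap L A c)
    (U : Submodule L A) (hU4 : Module.finrank L U = 4) (h1 : 1 ∈ U)
    (hUe : ∀ k, ∀ x ∈ U, e k * x - x * e k ∈ U) (hUf : ∀ k, ∀ x ∈ U, f k * x - x * f k ∈ U) :
    ∃ k, e k ∈ U ∧ f k ∈ U ∧ e k * f k ∈ U ∧ f k * e k ∈ U := by
  obtain ⟨j, hj⟩ : ∃ j, ∃ x ∈ U, ¬ (Commute (e j) x ∧ Commute (f j) x) := by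
    by_contra! h0
    have hle : U ≤ LinearMap.range (Algebra.linearMap L A) := by
      intro x hx
      obtain ⟨c, hc⟩ := hcent x fun k => h0 k x hx
      exact ⟨c, hc.symm⟩
    have := Submodule.finrank_mono hle
    have h2 := LinearMap.finrank_range_le (Algebra.linearMap L A)
    rw [Module.finrank_self] at h2
    omega
  obtain ⟨y, hy0, hye, hyf, hey, hhy, hfy⟩ :=
    (h j).exists_corner_ne_zero U (hUe j) (hUf j) hj
  have hli := (h j).linearIndependent_of_commute (L := L) hy0 hye hyf
  have hspan : U = Submodule.span L
      (Set.range ![1, e j * y, (e j * f j - f j * e j) * y, f j * y]) := by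
    have hfd : FiniteDimensional L U := Module.finite_of_finrank_eq_succ hU4
    refine (Submodule.eq_of_le_of_finrank_eq ?_ ?_).symm
    · rw [Submodule.span_le]
      rintro _ ⟨i, rfl⟩
      fin_cases i <;> assumption
    · rw [finrank_span_eq_card hli, hU4]; simp
  have key : ∀ z, Commute (e j) z → Commute (f j) z → e j * z ∈ U → ∃ c : L, z = c • y := by
    intro z hez hfz hz
    rw [hspan, Submodule.mem_span_range_iff_exists_fun] at hz
    obtain ⟨c, hc⟩ := hz
    refine ⟨c 1, ?_⟩
    have hli2 := (h j).symm
    rw [← sub_eq_zero]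
    refine hli2.eq_zero_of_mul_eq_zero ?_ ?_
    · exact hez.sub_right (hye.smul_right _)
    have h2 := (h j).sq_right
    have h3 := (h j).right_left_right
    simp only [Fin.sum_univ_four, Matrix.cons_val] at hc
    calc f j * (z - c 1 • y) = (f j * e j * f j) * z - c 1 • (f j * y) := by
          rw [h3, mul_sub, mul_smul_comm]
      _ = f j * (e j * z) * f j - c 1 • (f j * y) := by
          rw [mul_assoc (f j * e j), hfz.eq]; simp only [mul_assoc]
      _ = c 0 • (f j * f j) + c 1 • ((f j * e j * f j) * y) +
            c 2 • ((f j * e j * (f j * f j) - f j * f j * e j * f j) * y) +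
            c 3 • (f j * f j * y * f j) - c 1 • (f j * y) := by
          rw [← hc]
          simp only [mul_add, add_mul, mul_smul_comm, smul_mul_assoc, mul_one, mul_sub, sub_mul,
            mul_assoc]
          rw [← hyf.eq]
      _ = 0 := by rw [h3, h2]; simp
  -- A nilpotent element cannot act on the line spanned by `y` through a nonzero scalar.
  have hnil : ∀ d : A, d * d = 0 → Commute (e j) d → Commute (f j) d →
      d * (e j * y) - (e j * y) * d ∈ U → Commute d y := by
    intro d hd hed hfd hmem
    obtain ⟨c, hc⟩ := key (d * y - y * d)
      ((hed.mul_right hye).sub_right (hye.mul_right hed))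
      ((hfd.mul_right hyf).sub_right (hyf.mul_right hfd)) (by
        convert hmem using 1
        rw [← mul_assoc d, ← hed.eq]; noncomm_ring)
    have k1 : -(d * y * d) = c • (d * y) := by
      rw [← mul_smul_comm, ← hc, mul_sub, ← mul_assoc, hd, zero_mul, zero_sub, mul_assoc]
    have k2 : d * y * d = c • (y * d) := by
      rw [← smul_mul_assoc, ← hc, sub_mul, mul_assoc y, hd, mul_zero, sub_zero]
    have hc0 : c = 0 := by
      by_contra hc0
      have k3 : d * y = -(y * d) := by
        have : c • (d * y + y * d) = 0 := by rw [smul_add, ← k1, ← k2, neg_add_cancel]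
        rw [smul_eq_zero_iff_right hc0] at this
        exact eq_neg_of_add_eq_zero_left this
      have k4 : d * y * d = 0 := by
        rw [k3, neg_mul, mul_assoc, hd, mul_zero, neg_zero]
      have k5 : y * d = 0 := by
        rw [k4, eq_comm, smul_eq_zero_iff_right hc0] at k2
        exact k2
      rw [k3, k5, neg_zero, sub_zero, eq_comm, smul_eq_zero_iff_right hc0] at hc
      exact hy0 hc
    rw [hc0, zero_smul, sub_eq_zero] at hc
    exact hc
  obtain ⟨c, hc⟩ := hcent y fun k => by
    by_cases hk : k = j
    · subst hk; exact ⟨hye, hyf⟩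
    · obtain ⟨c1, c2, c3, c4⟩ := hcomm j k (Ne.symm hk)
      exact ⟨hnil _ (h k).sq_left c1 c3 (hUe k _ hey), hnil _ (h k).sq_right c2 c4 (hUf k _ hey)⟩
  have hc0 : c ≠ 0 := fun h0 => hy0 (by rw [hc, h0, map_zero])
  have hscal : ∀ x, x * y ∈ U → x ∈ U := by
    intro x hx
    rwa [hc, ← Algebra.commutes, ← Algebra.smul_def, U.smul_mem_iff hc0] at hx
  have hh := hscal _ hhy
  refine ⟨j, hscal _ hey, hscal _ hfy, ?_, ?_⟩
  · rw [← U.smul_mem_iff (two_ne_zero : (2 : L) ≠ 0)]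
    have : (2 : L) • (e j * f j) = 1 + (e j * f j - f j * e j) := by
      rw [← (h j).add_eq_one, two_smul]; abel
    rw [this]; exact U.add_mem h1 hh
  · rw [← U.smul_mem_iff (two_ne_zero : (2 : L) ≠ 0)]
    have : (2 : L) • (f j * e j) = 1 - (e j * f j - f j * e j) := by
      rw [← (h j).add_eq_one, two_smul]; abel
    rw [this]; exact U.sub_mem h1 hh

end MatrixUnits

/-! ### Kronecker products of families of `2 × 2` matrices -/

section Kron

open Matrix

variable {ι : Type*} [Fintype ι] {R S : Type*} [CommRing R] [CommRing S]

/-- The Kronecker product of a finite family of `2 × 2` matrices, the matrix of the tensor product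
of the corresponding linear maps. -/
def kron (a : ι → Matrix (Fin 2) (Fin 2) R) : Matrix (ι → Fin 2) (ι → Fin 2) R :=
  of fun p q => ∏ i, a i (p i) (q i)

theorem kron_apply (a : ι → Matrix (Fin 2) (Fin 2) R) (p q : ι → Fin 2) :
    kron a p q = ∏ i, a i (p i) (q i) := rfl

theorem kron_one : kron (1 : ι → Matrix (Fin 2) (Fin 2) R) = 1 := by
  ext p q
  simp only [kron_apply, Pi.one_apply, one_apply, Finset.prod_ite_zero, Finset.prod_const_one,
    Finset.mem_univ, true_imp_iff, funext_iff]

theorem kron_mul [DecidableEq ι] (a b : ι → Matrix (Fin 2) (Fin 2) R) :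
    kron a * kron b = kron (a * b) := by
  ext p q
  simp only [kron_apply, mul_apply, Pi.mul_apply, Finset.prod_univ_sum, Fintype.piFinset_univ,
    Finset.prod_mul_distrib]

theorem kron_smul (c : ι → R) (a : ι → Matrix (Fin 2) (Fin 2) R) :
    kron (fun i => c i • a i) = (∏ i, c i) • kron a := by
  ext p q
  simp [kron_apply, Finset.prod_mul_distrib]

theorem kron_map (φ : R →+* S) (a : ι → Matrix (Fin 2) (Fin 2) R) :
    (kron a).map φ = kron fun i => (a i).map φ := by
  ext p q
  simp [kron_apply]

theorem kron_submatrix (s : Equiv.Perm ι) (a : ι → Matrix (Fin 2) (Fin 2) R) :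
    (kron a).submatrix (· ∘ s) (· ∘ s) = kron fun i => a (s.symm i) := by
  ext p q
  simp only [kron_apply, submatrix_apply, Function.comp_apply]
  exact Fintype.prod_equiv s _ _ fun i => by simp

/-- If a Kronecker product of invertible matrices does not change when the factors are multiplied by
matrices, then these matrices are scalars whose product is `1`. -/
theorem exists_scalar_of_kron_eq [DecidableEq ι] {a b : ι → Matrix (Fin 2) (Fin 2) R}
    (ha : ∀ i, IsUnit (a i).det) (hab : kron a = kron b) :
    ∃ χ : ι → R, (∀ i, b i = χ i • a i) ∧ ∏ i, χ i = 1 := by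
  have hc : kron ((fun i => (a i)⁻¹) * b) = 1 := by
    rw [← kron_mul, ← hab, kron_mul, ← kron_one]
    congr 1
    ext1 i
    exact nonsing_inv_mul _ (ha i)
  set c := (fun i => (a i)⁻¹) * b with hcdef
  have h1 : ∏ i, c i 0 0 = 1 := by
    have := congrFun (congrFun hc 0) 0
    simpa [kron_apply] using this
  have hu : ∀ i, IsUnit (∏ k ∈ Finset.univ.erase i, c k 0 0) := fun i => by
    rw [← Finset.mul_prod_erase _ _ (Finset.mem_univ i), mul_comm] at h1
    exact IsUnit.of_mul_eq_one _ h1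
  -- Vary the `i`-th index only.
  have key : ∀ i x y, c i x y * ∏ k ∈ Finset.univ.erase i, c k 0 0 = if x = y then 1 else 0 := by
    intro i x y
    have := congrFun (congrFun hc (Function.update 0 i x)) (Function.update 0 i y)
    rw [kron_apply, ← Finset.mul_prod_erase _ _ (Finset.mem_univ i)] at this
    simp only [Function.update_self, one_apply] at this
    rw [Finset.prod_congr rfl fun k hk => by
      rw [Function.update_of_ne (Finset.ne_of_mem_erase hk),
        Function.update_of_ne (Finset.ne_of_mem_erase hk)]] at this
    simpa [(Function.update_injective (0 : ι → Fin 2) i).eq_iff] using this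
  refine ⟨fun i => c i 0 0, fun i => ?_, h1⟩
  have hci : c i = scalar (Fin 2) (c i 0 0) := by
    ext x y
    apply (hu i).mul_right_cancel
    rw [key]
    by_cases hxy : x = y
    · subst hxy
      simp [key]
    · simp [hxy]
  have : a i * c i = b i := by
    simp only [hcdef, Pi.mul_apply]
    rw [← mul_assoc, mul_nonsing_inv _ (ha i), one_mul]
  rw [← this]
  conv_lhs => rw [hci]
  rw [scalar_apply, ← smul_one_eq_diagonal, mul_smul_comm, mul_one]

variable [DecidableEq ι]

theorem kron_update_one_apply (j : ι) (x : Matrix (Fin 2) (Fin 2) R) (p q : ι → Fin 2) :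
    kron (Function.update 1 j x) p q =
      x (p j) (q j) * ∏ k ∈ Finset.univ.erase j, (1 : Matrix (Fin 2) (Fin 2) R) (p k) (q k) := by
  rw [kron_apply, ← Finset.mul_prod_erase _ _ (Finset.mem_univ j), Function.update_self]
  congr 1
  refine Finset.prod_congr rfl fun k hk => ?_
  rw [Function.update_of_ne (Finset.ne_of_mem_erase hk), Pi.one_apply]

/-- The algebra homomorphism `x ↦ 1 ⊗ ⋯ ⊗ x ⊗ ⋯ ⊗ 1` into the `j`-th factor. -/
def slot (R : Type*) [CommRing R] (j : ι) :
    Matrix (Fin 2) (Fin 2) R →ₐ[R] Matrix (ι → Fin 2) (ι → Fin 2) R :=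
  AlgHom.ofLinearMap
    { toFun := fun x => kron (Function.update 1 j x)
      map_add' := fun x y => by
        ext p q
        simp only [kron_update_one_apply, Matrix.add_apply, add_mul]
      map_smul' := fun c x => by
        ext p q
        simp only [kron_update_one_apply, Matrix.smul_apply, smul_eq_mul, mul_assoc, RingHom.id_apply] }
    (by simp [kron_one])
    (fun x y => by simp [kron_mul, ← Function.update_mul])

theorem slot_apply (j : ι) (x : Matrix (Fin 2) (Fin 2) R) :
    slot R j x = kron (Function.update 1 j x) := rfl

theorem slot_apply_apply (j : ι) (x : Matrix (Fin 2) (Fin 2) R) (p q : ι → Fin 2) :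
    slot R j x p q =
      x (p j) (q j) * ∏ k ∈ Finset.univ.erase j, (1 : Matrix (Fin 2) (Fin 2) R) (p k) (q k) :=
  kron_update_one_apply j x p q

theorem slot_map (φ : R →+* S) (j : ι) (x : Matrix (Fin 2) (Fin 2) R) :
    (slot R j x).map φ = slot S j (x.map φ) := by
  rw [slot_apply, slot_apply, kron_map]
  congr 1
  ext1 k
  by_cases hk : k = j
  · subst hk; simp
  · simp [hk, Matrix.map_one]

theorem slot_commute {j k : ι} (hjk : j ≠ k) (x y : Matrix (Fin 2) (Fin 2) R) :
    Commute (slot R j x) (slot R k y) := by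
  rw [Commute, SemiconjBy, slot_apply, slot_apply, kron_mul, kron_mul]
  congr 1
  ext1 l
  by_cases hj : l = j
  · subst hj; simp [hjk]
  · by_cases hk : l = k
    · subst hk; simp [hj]
    · simp [hj, hk]

theorem slot_injective [Nontrivial R] (j : ι) : Function.Injective (slot R j) := by
  intro x y hxy
  ext a b
  have := congrFun (congrFun hxy (Function.update 0 j a)) (Function.update 0 j b)
  rw [slot_apply_apply, slot_apply_apply] at this
  simp only [Function.update_self] at this
  rw [Finset.prod_congr rfl fun k hk => by
      rw [Function.update_of_ne (Finset.ne_of_mem_erase hk),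
        Function.update_of_ne (Finset.ne_of_mem_erase hk), Pi.zero_apply, one_apply_eq]] at this
  simpa using this

theorem isMatrixUnitPair_single :
    IsMatrixUnitPair (single (0 : Fin 2) (1 : Fin 2) (1 : R)) (single 1 0 1) where
  sq_left := by simp [single_mul_single_of_ne]
  sq_right := by simp [single_mul_single_of_ne]
  add_eq_one := by
    ext i j
    fin_cases i <;> fin_cases j <;> simp

theorem IsMatrixUnitPair.map {A B : Type*} [Ring A] [Ring B] {e f : A} (h : IsMatrixUnitPair e f)
    (φ : A →+* B) : IsMatrixUnitPair (φ e) (φ f) where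
  sq_left := by rw [← map_mul, h.sq_left, map_zero]
  sq_right := by rw [← map_mul, h.sq_right, map_zero]
  add_eq_one := by rw [← map_mul, ← map_mul, ← map_add, h.add_eq_one, map_one]

theorem slot_mem_of_single_mem {M : Submodule R (Matrix (ι → Fin 2) (ι → Fin 2) R)} {j : ι}
    (he : slot R j (single 0 1 1) ∈ M) (hf : slot R j (single 1 0 1) ∈ M)
    (hef : slot R j (single 0 1 1) * slot R j (single 1 0 1) ∈ M)
    (hfe : slot R j (single 1 0 1) * slot R j (single 0 1 1) ∈ M)
    (x : Matrix (Fin 2) (Fin 2) R) : slot R j x ∈ M := by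
  have hx : x = x 0 0 • (single 0 1 1 * single 1 0 1) + x 0 1 • single 0 1 1 +
      x 1 0 • single 1 0 1 + x 1 1 • (single 1 0 1 * single 0 1 1) := by
    ext i j
    fin_cases i <;> fin_cases j <;> simp
  rw [hx]
  simp only [map_add, map_smul, map_mul]
  exact M.add_mem (M.add_mem (M.add_mem (M.smul_mem _ hef) (M.smul_mem _ he)) (M.smul_mem _ hf))
    (M.smul_mem _ hfe)

/-- The tensor factors generate the algebra: a Kronecker product is a product of elements of the
factors. -/
theorem commute_kron_of_commute_slot {X : Matrix (ι → Fin 2) (ι → Fin 2) R}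
    (hX : ∀ j x, Commute (slot R j x) X) (a : ι → Matrix (Fin 2) (Fin 2) R) :
    Commute (kron a) X := by
  have key : ∀ s : Finset ι, Commute (kron fun i => if i ∈ s then a i else 1) X := by
    intro s
    induction s using Finset.induction_on with
    | empty =>
      have : (fun _ => 1 : ι → Matrix (Fin 2) (Fin 2) R) = 1 := rfl
      simp [this, kron_one, Commute.one_left]
    | insert j s hj ih =>
      have : (kron fun i => if i ∈ insert j s then a i else 1) =
          slot R j (a j) * kron fun i => if i ∈ s then a i else 1 := by
        rw [slot_apply, kron_mul]
        congr 1
        ext1 i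
        by_cases hi : i = j
        · subst hi; simp [hj]
        · simp [hi]
      rw [this]
      exact (hX j (a j)).mul_left ih
  simpa using key Finset.univ

theorem exists_scalar_of_commute_slot {X : Matrix (ι → Fin 2) (ι → Fin 2) R}
    (hX : ∀ j, Commute (slot R j (single 0 1 1)) X ∧ Commute (slot R j (single 1 0 1)) X) :
    ∃ c : R, X = algebraMap R _ c := by
  have h1 : ∀ j x, Commute (slot R j x) X := by
    intro j x
    have := slot_mem_of_single_mem (M := (Subalgebra.centralizer R {X}).toSubmodule) (j := j)
      (x := x)
    simp only [Subalgebra.mem_toSubmodule, Subalgebra.mem_centralizer_iff, Set.mem_singleton_iff,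
      forall_eq] at this
    exact (this (hX j).1.eq.symm (hX j).2.eq.symm ((hX j).1.mul_left (hX j).2).eq.symm
      ((hX j).2.mul_left (hX j).1).eq.symm).symm
  obtain ⟨c, hc⟩ := mem_range_scalar_of_commute_single (M := X) fun p q _ => by
    have : single p q 1 = kron fun i => single (p i) (q i) (1 : R) := by
      ext p' q'
      simp only [kron_apply, single_apply, Finset.prod_ite_zero, Finset.mem_univ, true_imp_iff,
        Finset.prod_const_one, funext_iff, forall_and]
    change Commute (single p q 1) X
    rw [this]
    exact commute_kron_of_commute_slot h1 _
  exact ⟨c, hc.symm⟩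

end Kron

/-! ### Rigidity of tensor decompositions -/

section Rigidity

open Matrix

variable {ι : Type*} [Fintype ι] [DecidableEq ι] {L : Type*} [Field L]

/-- The Skolem–Noether theorem for a matrix algebra over a field. -/
theorem exists_conj_of_matrix_algEquiv {n : Type*} [Fintype n] [DecidableEq n]
    (θ : Matrix n n L ≃ₐ[L] Matrix n n L) :
    ∃ f : Matrix n n L, IsUnit f.det ∧ ∀ x, θ x * f = f * x := by
  obtain ⟨T, hT⟩ := AlgEquiv.eq_linearEquivConjAlgEquiv
    ((Matrix.toLinAlgEquiv'.symm.trans θ).trans (Matrix.toLinAlgEquiv' (R := L) (n := n)))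
  refine ⟨LinearMap.toMatrix' T.toLinearMap, ?_, fun x => ?_⟩
  · have h1 : LinearMap.toMatrix' T.toLinearMap * LinearMap.toMatrix' T.symm.toLinearMap = 1 := by
      rw [← LinearMap.toMatrix'_comp]; simp
    exact isUnit_det_of_right_inverse h1
  · have h := congrArg (fun g => g (Matrix.toLinAlgEquiv' x)) hT
    simp only [AlgEquiv.trans_apply, AlgEquiv.symm_apply_apply, LinearEquiv.conjAlgEquiv_apply] at h
    have h2 := congrArg (fun g => LinearMap.toMatrix' (g ∘ₗ T.toLinearMap)) h
    simp only [LinearMap.comp_assoc, LinearEquiv.symm_comp, LinearMap.comp_id,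
      LinearMap.toMatrix'_comp] at h2
    have h3 : ∀ y : Matrix n n L, LinearMap.toMatrix' (Matrix.toLinAlgEquiv' y) = y := fun y =>
      LinearMap.toMatrix'_toLin' y
    rwa [h3, h3] at h2

theorem kron_mul_submatrix {R : Type*} [CommRing R] (s : Equiv.Perm ι)
    (a b : ι → Matrix (Fin 2) (Fin 2) R) :
    kron a * (kron b).submatrix (· ∘ s) id =
      (kron fun i => a (s i) * b i).submatrix (· ∘ s) id := by
  have h : kron a = (kron fun i => a (s i)).submatrix (· ∘ s) (· ∘ s) := by
    rw [kron_submatrix]; simp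
  have h2 := Matrix.submatrix_mul (kron fun i => a (s i)) (kron b) (fun p : ι → Fin 2 => p ∘ s)
    (fun p : ι → Fin 2 => p ∘ s) id
    (Equiv.bijective (Equiv.arrowCongr s.symm (Equiv.refl (Fin 2))))
  rw [h, ← h2, kron_mul]
  rfl

theorem submatrix_mul_kron {R : Type*} [CommRing R] (s : Equiv.Perm ι)
    (a b : ι → Matrix (Fin 2) (Fin 2) R) :
    (kron b).submatrix (· ∘ s) id * kron a =
      (kron fun i => b i * a i).submatrix (· ∘ s) id := by
  have h2 := Matrix.submatrix_mul (kron b) (kron a) (fun p : ι → Fin 2 => p ∘ s) id id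
    Function.bijective_id
  rw [kron_mul] at h2
  exact h2.symm

theorem isUnit_submatrix_kron {R : Type*} [CommRing R] (s : Equiv.Perm ι)
    {f : ι → Matrix (Fin 2) (Fin 2) R} (hf : ∀ i, IsUnit (f i).det) :
    IsUnit ((kron f).submatrix (· ∘ s) id) := by
  have h1 : IsUnit (kron f) := by
    refine IsUnit.of_mul_eq_one (kron fun i => (f i)⁻¹) ?_
    rw [kron_mul, ← kron_one]
    congr 1
    ext1 i
    exact mul_nonsing_inv _ (hf i)
  have h2 := (isUnit_submatrix_equiv (e₁ := Equiv.arrowCongr s.symm (Equiv.refl (Fin 2)))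
    (e₂ := Equiv.refl _)).2 h1
  exact h2

variable {H : Type*} [CommRing H] [Algebra L H]
  {v w : ι → Matrix (Fin 2) (Fin 2) H} {Φ : Matrix (ι → Fin 2) (ι → Fin 2) L}

/-- If `⨂ v i` and `⨂ w i` are conjugate by a constant matrix `Φ`, then conjugation by the
specializations of `⨂ v i` at constant matrices `g i` of determinant `1` preserves the image under
conjugation by `Φ` of every tensor factor of the matrix algebra. -/
theorem exists_slot_of_specialization (hv : ∀ i, (v i).det = 1) (hw : ∀ i, IsUnit (w i).det)
    (hΦ : IsUnit Φ)
    (hcomm : kron v * Φ.map (algebraMap L H) = Φ.map (algebraMap L H) * kron w)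
    {g : ι → Matrix (Fin 2) (Fin 2) L} (l : H →ₗ[L] L)
    (hl : ∀ p q p' q', l (kron v p q * kron (fun i => (v i).adjugate) p' q') =
      kron g p q * kron (fun i => (g i).adjugate) p' q') (i : ι) (x : Matrix (Fin 2) (Fin 2) L) :
    ∃ y, kron g * (Φ * slot L i x * Φ⁻¹) * kron (fun i => (g i).adjugate) =
      Φ * slot L i y * Φ⁻¹ := by
  have hΦ' := (isUnit_iff_isUnit_det Φ).1 hΦ
  set M := Φ.map (algebraMap L H) with hM
  set M' := Φ⁻¹.map (algebraMap L H) with hM'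
  have hMM' : M * M' = 1 := by
    rw [hM, hM', ← Matrix.map_mul, mul_nonsing_inv _ hΦ', Matrix.map_one _ (map_zero _) (map_one _)]
  have hM'M : M' * M = 1 := by
    rw [hM, hM', ← Matrix.map_mul, nonsing_inv_mul _ hΦ', Matrix.map_one _ (map_zero _) (map_one _)]
  have hvv : kron v * kron (fun i => (v i).adjugate) = 1 := by
    rw [kron_mul, ← kron_one]
    congr 1
    ext1 i
    rw [Pi.mul_apply, mul_adjugate, hv, one_smul, Pi.one_apply]
  have hww : kron (fun i => (w i)⁻¹) * kron w = 1 := by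
    rw [kron_mul, ← kron_one]
    congr 1
    ext1 i
    exact nonsing_inv_mul _ (hw i)
  have hinv : M' * kron (fun i => (v i).adjugate) = kron (fun i => (w i)⁻¹) * M' := by
    have h1 : kron (fun i => (w i)⁻¹) * M' * kron v = M' := by
      calc _ = kron (fun i => (w i)⁻¹) * M' * (kron v * M) * M' := by
            rw [mul_assoc _ (kron v * M), mul_assoc (kron v), hMM', mul_one]
        _ = kron (fun i => (w i)⁻¹) * (M' * M) * kron w * M' := by
            rw [hcomm]; simp only [mul_assoc]
        _ = M' := by rw [hM'M, mul_one, hww, one_mul]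
    calc _ = kron (fun i => (w i)⁻¹) * M' * kron v * kron (fun i => (v i).adjugate) := by rw [h1]
      _ = _ := by rw [mul_assoc, hvv, mul_one]
  have hslot : kron w * slot H i (x.map (algebraMap L H)) * kron (fun i => (w i)⁻¹) =
      slot H i (w i * x.map (algebraMap L H) * (w i)⁻¹) := by
    rw [slot_apply, slot_apply, kron_mul, kron_mul]
    congr 1
    ext1 k
    by_cases hk : k = i
    · subst hk; simp
    · simp [hk, mul_nonsing_inv _ (hw k)]
  have key : kron v * (Φ * slot L i x * Φ⁻¹).map (algebraMap L H) *
      kron (fun i => (v i).adjugate) =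
      M * slot H i (w i * x.map (algebraMap L H) * (w i)⁻¹) * M' := by
    rw [Matrix.map_mul, Matrix.map_mul, slot_map, ← hM, ← hM', ← hslot]
    calc _ = (kron v * M) * slot H i (x.map (algebraMap L H)) *
          (M' * kron (fun i => (v i).adjugate)) := by simp only [mul_assoc]
      _ = _ := by rw [hcomm, hinv]; simp only [mul_assoc]
  -- Apply the linear form `l` to all entries.
  have hl1 : ∀ X : Matrix (ι → Fin 2) (ι → Fin 2) L,
      (kron v * X.map (algebraMap L H) * kron (fun i => (v i).adjugate)).map l =
        kron g * X * kron (fun i => (g i).adjugate) := by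
    intro X
    ext p q
    simp only [Matrix.map_apply, mul_apply, Finset.sum_mul, map_sum]
    refine Finset.sum_congr rfl fun q' _ => Finset.sum_congr rfl fun p' _ => ?_
    rw [mul_comm (kron v p p'), mul_assoc, ← Algebra.smul_def, map_smul, hl, smul_eq_mul]
    ring
  have hl2 : ∀ Y : Matrix (ι → Fin 2) (ι → Fin 2) H, (M * Y * M').map l = Φ * Y.map l * Φ⁻¹ := by
    intro Y
    ext p q
    simp only [hM, hM', Matrix.map_apply, mul_apply, Finset.sum_mul, map_sum]
    refine Finset.sum_congr rfl fun q' _ => Finset.sum_congr rfl fun p' _ => ?_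
    rw [mul_assoc, ← Algebra.smul_def, map_smul, mul_comm (Y _ _), ← Algebra.smul_def, map_smul,
      smul_eq_mul, smul_eq_mul]
    ring
  have hl3 : ∀ y : Matrix (Fin 2) (Fin 2) H, (slot H i y).map l = slot L i (y.map l) := by
    intro y
    ext p q
    have : ∏ k ∈ Finset.univ.erase i, (1 : Matrix (Fin 2) (Fin 2) H) (p k) (q k) =
        algebraMap L H (∏ k ∈ Finset.univ.erase i, (1 : Matrix (Fin 2) (Fin 2) L) (p k) (q k)) := by
      rw [map_prod]
      refine Finset.prod_congr rfl fun k _ => ?_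
      simp only [one_apply]
      split_ifs <;> simp
    rw [Matrix.map_apply, slot_apply_apply, slot_apply_apply, this, mul_comm, ← Algebra.smul_def,
      map_smul, Matrix.map_apply, smul_eq_mul, mul_comm]
  refine ⟨(w i * x.map (algebraMap L H) * (w i)⁻¹).map l, ?_⟩
  rw [← hl1, key, hl2, hl3]

/-- Each tensor factor of the matrix algebra is carried by conjugation by `Φ` to a tensor factor. -/
theorem exists_slot_conj [CharZero L] (hv : ∀ i, (v i).det = 1) (hw : ∀ i, IsUnit (w i).det) (hΦ : IsUnit Φ)
    (hcomm : kron v * Φ.map (algebraMap L H) = Φ.map (algebraMap L H) * kron w)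
    (hpt : ∀ g : ι → Matrix (Fin 2) (Fin 2) L, (∀ i, (g i).det = 1) → ∃ l : H →ₗ[L] L,
      ∀ p q p' q', l (kron v p q * kron (fun i => (v i).adjugate) p' q') =
        kron g p q * kron (fun i => (g i).adjugate) p' q') (i : ι) :
    ∃ j, ∃ θ : Matrix (Fin 2) (Fin 2) L ≃ₐ[L] Matrix (Fin 2) (Fin 2) L,
      ∀ x, Φ * slot L i x = slot L j (θ x) * Φ := by
  have hΦ' := (isUnit_iff_isUnit_det Φ).1 hΦ
  let c : Matrix (ι → Fin 2) (ι → Fin 2) L ≃ₐ[L] Matrix (ι → Fin 2) (ι → Fin 2) L :=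
    MulSemiringAction.toAlgEquiv L _ (ConjAct.toConjAct hΦ.unit)
  have hc : ∀ X, c X = Φ * X * Φ⁻¹ := by
    intro X
    change ConjAct.toConjAct hΦ.unit • X = _
    rw [ConjAct.units_smul_def, ConjAct.ofConjAct_toConjAct, coe_units_inv]
    rfl
  let ψ := c.toAlgHom.comp (slot L i)
  have hψ : ∀ x, ψ x = Φ * slot L i x * Φ⁻¹ := fun x => hc _
  have hψinj : Function.Injective ψ := c.injective.comp (slot_injective i)
  let U := LinearMap.range ψ.toLinearMap
  have hU4 : Module.finrank L U = 4 := by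
    rw [LinearMap.finrank_range_of_inj hψinj, Module.finrank_matrix]
    simp
  -- Conjugation by the unipotent matrices `1 ± d` with `d² = 0` gives the commutator with `d`.
  have hstab : ∀ k, ∀ d : Matrix (Fin 2) (Fin 2) L, (∀ t : L, (1 + t • d).det = 1) →
      (∀ t : L, (1 + t • d).adjugate = 1 - t • d) → ∀ X ∈ U,
      slot L k d * X - X * slot L k d ∈ U := by
    rintro k d hd hd' _ ⟨x, rfl⟩
    change slot L k d * ψ x - ψ x * slot L k d ∈ U
    have h1 : ∀ t : L, (1 + t • slot L k d) * ψ x * (1 - t • slot L k d) ∈ U := by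
      intro t
      obtain ⟨l, hl⟩ := hpt (Function.update 1 k (1 + t • d)) fun i => by
        by_cases hi : i = k
        · subst hi; simp [hd]
        · simp [hi]
      obtain ⟨y, hy⟩ := exists_slot_of_specialization hv hw hΦ hcomm l hl i x
      have h2 : (fun i => (Function.update (1 : ι → Matrix (Fin 2) (Fin 2) L)
          k (1 + t • d) i).adjugate) =
          Function.update (1 : ι → Matrix (Fin 2) (Fin 2) L) k (1 - t • d) := by
        ext1 i
        by_cases hi : i = k
        · subst hi; simp [hd']
        · simp [hi]
      rw [h2, ← slot_apply, ← slot_apply, map_add, map_sub, map_smul, map_one] at hy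
      exact ⟨y, by rw [hψ x, hy]; exact hψ y⟩
    have h2 := U.sub_mem (h1 1) (h1 (-1))
    rw [← U.smul_mem_iff (two_ne_zero : (2 : L) ≠ 0), two_smul]
    convert h2 using 1
    simp only [one_smul, neg_smul]
    noncomm_ring
  obtain ⟨j, h1, h2, h3, h4⟩ := exists_matrixUnitPair_mem (L := L)
    (fun k => slot L k (single 0 1 1)) (fun k => slot L k (single 1 0 1))
    (fun k => isMatrixUnitPair_single.map (slot L k).toRingHom)
    (fun j k hjk => ⟨slot_commute hjk _ _, slot_commute hjk _ _, slot_commute hjk _ _,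
      slot_commute hjk _ _⟩)
    (fun x hx => exists_scalar_of_commute_slot hx) U hU4 ⟨1, map_one ψ⟩
    (fun k => hstab k _ (by simp [det_fin_two]) (by
      intro t; ext a b; fin_cases a <;> fin_cases b <;> simp [adjugate_fin_two]))
    (fun k => hstab k _ (by simp [det_fin_two]) (by
      intro t; ext a b; fin_cases a <;> fin_cases b <;> simp [adjugate_fin_two]))
  have hmem : ∀ x, slot L j x ∈ U := slot_mem_of_single_mem h1 h2 h3 h4
  have hle : (slot L j).range ≤ ψ.range := by
    rintro _ ⟨x, rfl⟩
    exact hmem x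
  let θ' : Matrix (Fin 2) (Fin 2) L →ₐ[L] Matrix (Fin 2) (Fin 2) L :=
    ((AlgEquiv.ofInjective ψ hψinj).symm.toAlgHom.comp (Subalgebra.inclusion hle)).comp
      (AlgHom.rangeRestrict (slot L j))
  have hθ' : ∀ x, ψ (θ' x) = slot L j x := by
    intro x
    have := (AlgEquiv.ofInjective ψ hψinj).apply_symm_apply
      (Subalgebra.inclusion hle ((slot L j).rangeRestrict x))
    exact congrArg Subtype.val this
  have hθinj : Function.Injective θ' := by
    intro x y hxy
    apply slot_injective (R := L) j
    rw [← hθ', hxy, hθ']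
  let θ := AlgEquiv.ofBijective θ' ⟨hθinj,
    (LinearMap.injective_iff_surjective (f := θ'.toLinearMap)).1 hθinj⟩
  refine ⟨j, θ.symm, fun x => ?_⟩
  have h5 : slot L j (θ.symm x) = ψ x := by
    rw [← hθ']
    exact congrArg ψ (θ.apply_symm_apply x)
  rw [h5, hψ, mul_assoc, nonsing_inv_mul _ hΦ', mul_one]

/-- If `⨂ v i` and `⨂ w i` are conjugate by a constant matrix `Φ` and every tuple of constant
matrices of determinant `1` is a specialization of `v`, then `Φ` is, up to a permutation of the
factors, a tensor product of matrices `f i`, and conjugation by `f i` carries `w i` to a multiple of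
`v (s i)`. -/
theorem exists_factorization [CharZero L] [Nonempty ι] (hv : ∀ i, (v i).det = 1) (hw : ∀ i, IsUnit (w i).det)
    (hΦ : IsUnit Φ)
    (hcomm : kron v * Φ.map (algebraMap L H) = Φ.map (algebraMap L H) * kron w)
    (hpt : ∀ g : ι → Matrix (Fin 2) (Fin 2) L, (∀ i, (g i).det = 1) → ∃ l : H →ₗ[L] L,
      ∀ p q p' q', l (kron v p q * kron (fun i => (v i).adjugate) p' q') =
        kron g p q * kron (fun i => (g i).adjugate) p' q') :
    ∃ (s : Equiv.Perm ι) (f : ι → Matrix (Fin 2) (Fin 2) L) (χ : ι → H),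
      (∀ i, IsUnit (f i).det) ∧ Φ = (kron f).submatrix (· ∘ s) id ∧
      (∀ i, (f i).map (algebraMap L H) * w i =
        χ i • (v (s i) * (f i).map (algebraMap L H))) ∧ ∏ i, χ i = 1 := by
  choose s θ hθ using exists_slot_conj hv hw hΦ hcomm hpt
  have hs : Function.Injective s := by
    intro i j hij
    by_contra hne
    have h1 : ∀ x y, Commute (slot L (s i) x) (slot L (s i) y) := by
      intro x y
      have h2 := slot_commute (R := L) hne ((θ i).symm x) ((θ j).symm y)
      have h3 := hθ i ((θ i).symm x)
      have h4 := hθ j ((θ j).symm y)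
      rw [AlgEquiv.apply_symm_apply] at h3 h4
      rw [← hij] at h4
      set X := slot L i ((θ i).symm x)
      set Y := slot L j ((θ j).symm y)
      apply hΦ.mul_right_cancel
      calc _ = Φ * (X * Y) := by rw [mul_assoc, ← h4, ← mul_assoc, ← h3, mul_assoc]
        _ = Φ * (Y * X) := by rw [h2.eq]
        _ = _ := by rw [← mul_assoc, h4, mul_assoc, h3, mul_assoc]
    have h2 := (h1 (single 0 1 1) (single 1 0 1)).eq
    rw [← map_mul, ← map_mul] at h2
    have h3 := congrFun (congrFun (slot_injective _ h2) 0) 0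
    simp at h3
  have hsb : Function.Bijective s := Finite.injective_iff_bijective.1 hs
  let σ : Equiv.Perm ι := Equiv.ofBijective s hsb
  choose f hfu hf using fun i => exists_conj_of_matrix_algEquiv (θ i)
  set Ψ := (kron f).submatrix (fun p : ι → Fin 2 => p ∘ σ) id with hΨ
  have hΨu : IsUnit Ψ := isUnit_submatrix_kron σ hfu
  have hΨu' := (isUnit_iff_isUnit_det Ψ).1 hΨu
  have hΨθ : ∀ i x, Ψ * slot L i x = slot L (s i) (θ i x) * Ψ := by
    intro i x
    rw [hΨ, slot_apply, slot_apply, kron_mul_submatrix, submatrix_mul_kron]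
    congr 2
    ext1 k
    by_cases hk : k = i
    · subst hk
      simp only [Function.update_self]
      have : σ k = s k := rfl
      rw [this, Function.update_self, hf]
    · have : σ k ≠ s i := fun h => hk (hs h)
      simp [hk, this]
  obtain ⟨c, hc⟩ : ∃ c : L, Φ * Ψ⁻¹ = algebraMap L _ c := by
    have : ∀ j x, Commute (slot L j x) (Φ * Ψ⁻¹) := by
      intro j x
      obtain ⟨i, rfl⟩ := hsb.2 j
      obtain ⟨y, rfl⟩ := (θ i).surjective x
      rw [Commute, SemiconjBy]
      calc _ = (slot L (s i) (θ i y) * Φ) * Ψ⁻¹ := by rw [mul_assoc]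
        _ = Φ * Ψ⁻¹ * (Ψ * slot L i y) * Ψ⁻¹ := by
          rw [← hθ, mul_assoc Φ Ψ⁻¹, ← mul_assoc Ψ⁻¹ Ψ, nonsing_inv_mul _ hΨu', one_mul]
        _ = _ := by
          rw [hΨθ, mul_assoc, mul_assoc _ Ψ, mul_nonsing_inv _ hΨu', mul_one]
    exact exists_scalar_of_commute_slot fun j => ⟨this _ _, this _ _⟩
  have hΦΨ : Φ = c • Ψ := by
    calc Φ = Φ * Ψ⁻¹ * Ψ := by rw [mul_assoc, nonsing_inv_mul _ hΨu', mul_one]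
      _ = c • Ψ := by rw [hc, Algebra.smul_def]
  have hc0 : c ≠ 0 := by
    rintro rfl
    rw [zero_smul] at hΦΨ
    rw [hΦΨ] at hΦ
    exact not_isUnit_zero hΦ
  -- The scalar is absorbed into one of the factors.
  obtain ⟨i₀⟩ := ‹Nonempty ι›
  set f' := fun i => (if i = i₀ then c else 1) • f i with hf'
  have hf'u : ∀ i, IsUnit (f' i).det := by
    intro i
    rw [hf', det_smul]
    refine IsUnit.mul (IsUnit.pow _ ?_) (hfu i)
    split_ifs <;> simp [hc0]
  have hΦf' : Φ = (kron f').submatrix (fun p : ι → Fin 2 => p ∘ σ) id := by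
    rw [hΦΨ, hf', kron_smul, Finset.prod_ite_eq' Finset.univ i₀ fun _ => c]
    simp [hΨ, Matrix.submatrix_smul]
  have h1 : kron (fun i => v (σ i) * (f' i).map (algebraMap L H)) =
      kron (fun i => (f' i).map (algebraMap L H) * w i) := by
    have h2 : Φ.map (algebraMap L H) =
        (kron fun i => (f' i).map (algebraMap L H)).submatrix (fun p : ι → Fin 2 => p ∘ σ) id := by
      rw [hΦf', ← kron_map]
      rfl
    rw [h2, kron_mul_submatrix, submatrix_mul_kron] at hcomm
    have h3 := congrArg (fun X => X.submatrix (fun p : ι → Fin 2 => p ∘ σ.symm) id) hcomm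
    have h5 : ∀ X : Matrix (ι → Fin 2) (ι → Fin 2) H,
        (X.submatrix (fun p : ι → Fin 2 => p ∘ σ) id).submatrix (fun p => p ∘ σ.symm) id = X := by
      intro X
      ext p q
      simp [Function.comp_assoc]
    rwa [h5, h5] at h3
  obtain ⟨χ, hχ, hχ1⟩ := exists_scalar_of_kron_eq (fun i => by
    have h4 : ((f' i).map (algebraMap L H)).det = algebraMap L H (f' i).det :=
      ((algebraMap L H).map_det (f' i)).symm
    rw [det_mul, hv, one_mul, h4]
    exact (hf'u i).map _) h1
  exact ⟨σ, f', χ, hf'u, hΦf', hχ, hχ1⟩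

end Rigidity

/-! ### The coordinate ring of `SL(2)` -/

namespace GLn

open Matrix
open Algebra.TensorProduct (includeLeft includeRight)

variable {L : Type u} [Field L] {n : ℕ}

section

variable {A C : Type*} [CommRing A] [Algebra L A] [CommRing C] [Algebra L C]

theorem point_algebraMap_X (a : Matrix (Fin n) (Fin n) A) (ha : IsUnit a.det) (i j : Fin n) :
    point (L := L) a ha (algebraMap (MvPolynomial (Fin n × Fin n) L) (Coord L n)
      (MvPolynomial.X (i, j))) = a i j := by
  have h := IsLocalization.Away.lift_eq (S := Coord L n) (genericDet L n)
    (g := (MvPolynomial.aeval (R := L) (fun p : Fin n × Fin n => a p.1 p.2)).toRingHom)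
    (isUnit_aeval_genericDet (L := L) a ha) (MvPolynomial.X (i, j))
  refine Eq.trans h ?_
  simp

theorem algHom_ext_coord {f g : Coord L n →ₐ[L] A}
    (h : ∀ i j, f (algebraMap (MvPolynomial (Fin n × Fin n) L) (Coord L n)
      (MvPolynomial.X (i, j))) =
      g (algebraMap (MvPolynomial (Fin n × Fin n) L) (Coord L n) (MvPolynomial.X (i, j)))) :
    f = g := by
  refine IsLocalization.algHom_ext (Submonoid.powers (genericDet L n)) ?_
  refine MvPolynomial.algHom_ext fun p => ?_
  exact h p.1 p.2

theorem point_genericDet (a : Matrix (Fin n) (Fin n) A) (ha : IsUnit a.det) :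
    point (L := L) a ha (algebraMap _ _ (genericDet L n)) = a.det := by
  rw [genericDet, RingHom.map_det, ← RingHom.coe_coe (point a ha), RingHom.map_det]
  congr 1
  ext i j
  simp [point_algebraMap_X]

/-- The `A`-point of `SL(n)` given by a matrix of determinant `1` over an `L`-algebra `A`. -/
noncomputable def pointSL (a : Matrix (Fin n) (Fin n) A) (ha : a.det = 1) :
    CoordSL L n →ₐ[L] A :=
  Ideal.Quotient.liftₐ (idealSL L n) (point a (ha ▸ isUnit_one)) fun x hx => by
    have h : idealSL L n ≤ RingHom.ker (point (L := L) a (ha ▸ isUnit_one)) := by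
      rw [idealSL, Ideal.span_le, Set.singleton_subset_iff]
      change point a _ _ = 0
      rw [map_sub, map_one, point_genericDet, ha, sub_self]
    exact h hx

theorem pointSL_generic (a : Matrix (Fin n) (Fin n) A) (ha : a.det = 1) (i j : Fin n) :
    pointSL a ha (genericSL L n i j) = a i j :=
  point_algebraMap_X a (ha ▸ isUnit_one) i j

theorem pointSL_adjugate (a : Matrix (Fin n) (Fin n) A) (ha : a.det = 1) (i j : Fin n) :
    pointSL (L := L) a ha ((genericSL L n).adjugate i j) = a.adjugate i j := by
  have h1 := (pointSL (L := L) a ha).toRingHom.map_adjugate (genericSL L n)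
  have h2 : (pointSL (L := L) a ha).toRingHom.mapMatrix (genericSL L n) = a := by
    ext i k
    exact pointSL_generic a ha i k
  rw [h2] at h1
  exact congrFun (congrFun h1 i) j

theorem algHom_ext_coordSL {f g : CoordSL L n →ₐ[L] A}
    (h : ∀ i j, f (genericSL L n i j) = g (genericSL L n i j)) : f = g := by
  have h1 : f.comp (toSL L n) = g.comp (toSL L n) := algHom_ext_coord h
  refine AlgHom.ext fun x => ?_
  obtain ⟨y, rfl⟩ := Ideal.Quotient.mk_surjective x
  exact DFunLike.congr_fun h1 y

theorem comp_pointSL (f : A →ₐ[L] C) (a : Matrix (Fin n) (Fin n) A) (ha : a.det = 1)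
    (ha' : (a.map f).det = 1) : f.comp (pointSL a ha) = pointSL (a.map f) ha' :=
  algHom_ext_coordSL fun i j => by
    rw [AlgHom.comp_apply, pointSL_generic, pointSL_generic, Matrix.map_apply]

theorem det_map_eq_one (f : A →ₐ[L] C) {a : Matrix (Fin n) (Fin n) A} (ha : a.det = 1) :
    (a.map f).det = 1 := by
  have := f.map_det a
  rw [ha, map_one] at this
  exact this.symm

/-- The matrix product of `x` and `y` with entries in different algebras. -/
noncomputable def tensorMul (x : Matrix (Fin n) (Fin n) A) (y : Matrix (Fin n) (Fin n) C) :
    Matrix (Fin n) (Fin n) (A ⊗[L] C) :=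
  x.map (includeLeft : A →ₐ[L] A ⊗[L] C) * y.map (includeRight : C →ₐ[L] A ⊗[L] C)

theorem tensorMul_apply (x : Matrix (Fin n) (Fin n) A) (y : Matrix (Fin n) (Fin n) C)
    (i k : Fin n) : tensorMul (L := L) x y i k = ∑ l, x i l ⊗ₜ[L] y l k := by
  simp [tensorMul, mul_apply]

theorem det_tensorMul {x : Matrix (Fin n) (Fin n) A} {y : Matrix (Fin n) (Fin n) C}
    (hx : x.det = 1) (hy : y.det = 1) : (tensorMul (L := L) x y).det = 1 := by
  rw [tensorMul, det_mul, det_map_eq_one _ hx, det_map_eq_one _ hy, one_mul]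

end

open MvPolynomial in
theorem irreducible_genericDet_sub_one : Irreducible (genericDet L 2 - 1) := by
  have h : genericDet L 2 - 1 = X (0, 0) * X (1, 1) + (-(X (0, 1) * X (1, 0) + 1)) := by
    rw [genericDet, det_fin_two]
    simp only [mvPolynomialX_apply]
    ring
  have hdisj : (1, 1) ∉ (-(X (0, 1) * X (1, 0) + 1) : MvPolynomial (Fin 2 × Fin 2) L).vars := by
    rw [vars_neg]
    intro h1
    have h2 := vars_add_subset _ _ h1
    rw [vars_one, Finset.union_empty] at h2
    have h3 := vars_mul _ _ h2
    simp [vars_X] at h3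
  rw [h]
  refine irreducible_mul_X_add _ _ (1, 1) (X_ne_zero _) (by simp [vars_X]) hdisj ?_
  rw [(X_prime (R := L) (i := ((0, 0) : Fin 2 × Fin 2))).irreducible.isRelPrime_iff_not_dvd]
  rintro ⟨q, hq⟩
  have := congrArg (MvPolynomial.eval (0 : Fin 2 × Fin 2 → L)) hq
  simp at this

theorem isPrime_idealSL : (idealSL L 2).IsPrime := by
  have h1 : (Ideal.span {genericDet L 2 - 1}).IsPrime :=
    (Ideal.span_singleton_prime irreducible_genericDet_sub_one.ne_zero).2
      irreducible_genericDet_sub_one.prime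
  have h2 := IsLocalization.isPrime_of_isPrime_disjoint (Submonoid.powers (genericDet L 2))
    (Coord L 2) _ h1 ?_
  · rwa [Ideal.map_span, Set.image_singleton, map_sub, map_one] at h2
  · rw [Set.disjoint_left]
    rintro _ ⟨k, rfl⟩ hk
    have h3 : genericDet L 2 ^ k - 1 ∈ Ideal.span {genericDet L 2 - 1} :=
      Ideal.mem_span_singleton.2 (by simpa using sub_dvd_pow_sub_pow (genericDet L 2) 1 k)
    refine h1.ne_top ((Ideal.eq_top_iff_one _).2 ?_)
    simpa using Ideal.sub_mem _ hk h3

instance : IsDomain (CoordSL L 2) :=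
  have := isPrime_idealSL (L := L)
  inferInstanceAs (IsDomain (Coord L 2 ⧸ idealSL L 2))

open Polynomial in
/-- An invertible function on `SL(n)` with value `1` at the identity is trivial on every polynomial
curve through the identity, because the units of a polynomial ring are constants. -/
theorem pointSL_curve_eq_one {z : CoordSL L n} (hz : IsUnit z)
    (h1 : pointSL (1 : Matrix (Fin n) (Fin n) L) det_one z = 1)
    (g : Matrix (Fin n) (Fin n) L[X]) (hg : g.det = 1) (hg0 : g.map (aeval (0 : L)) = 1) :
    pointSL g hg z = 1 := by
  obtain ⟨c, hc, hcz⟩ := Polynomial.isUnit_iff.1 (hz.map (pointSL g hg))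
  have h2 := DFunLike.congr_fun (comp_pointSL (aeval (0 : L)) g hg (det_map_eq_one _ hg)) z
  rw [AlgHom.comp_apply, ← hcz, aeval_C] at h2
  rw [← hcz]
  have h3 : c = 1 := by
    rw [← h1]
    refine h2.trans ?_
    congr 2
  rw [h3, C_1]

theorem eq_mul_unipotent {K : Type*} [Field K] {a b c d : K} (hc : c ≠ 0)
    (h : a * d - b * c = 1) :
    !![a, b; c, d] = !![1, (a - 1) / c; 0, 1] * !![1, 0; c, 1] * !![1, (d - 1) / c; 0, 1] := by
  have h1 : b = (a * d - 1) / c := by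
    rw [eq_div_iff hc]; linear_combination -h
  rw [h1]
  ext i j
  fin_cases i <;> fin_cases j <;> simp [mul_apply, Fin.sum_univ_two] <;> field_simp <;> ring

/-- `SL(2)` has no nontrivial characters: it is generated by unipotent one-parameter groups. -/
theorem eq_one_of_multiplicative {z : CoordSL L 2}
    (h1 : pointSL (1 : Matrix (Fin 2) (Fin 2) L) det_one z = 1)
    (hmul : pointSL (L := L) (tensorMul (genericSL L 2) (genericSL L 2))
      (det_tensorMul (det_genericSL L 2) (det_genericSL L 2)) z = z ⊗ₜ[L] z) : z = 1 := by
  have hmul' : ∀ (K : Type u) [CommRing K] [Algebra L K] (g g' : Matrix (Fin 2) (Fin 2) K)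
      (hg : g.det = 1) (hg' : g'.det = 1),
      pointSL (L := L) (g * g') (by rw [det_mul, hg, hg', one_mul]) z =
        pointSL g hg z * pointSL g' hg' z := by
    intro K _ _ g g' hg hg'
    have h2 := congrArg (Algebra.TensorProduct.lift (pointSL (L := L) g hg) (pointSL g' hg')
      fun _ _ => mul_comm _ _) hmul
    have hl : ∀ x y, Algebra.TensorProduct.lift (pointSL (L := L) g hg) (pointSL g' hg')
        (fun _ _ => mul_comm _ _) (x ⊗ₜ[L] y) = pointSL g hg x * pointSL g' hg' y :=
      fun x y => Algebra.TensorProduct.lift_tmul _ _ _ x y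
    rw [hl, ← AlgHom.comp_apply] at h2
    rw [← h2]
    congr 1
    refine algHom_ext_coordSL fun i j => ?_
    rw [AlgHom.comp_apply, pointSL_generic, pointSL_generic]
    rw [tensorMul_apply, map_sum, mul_apply]
    refine Finset.sum_congr rfl fun l _ => ?_
    rw [hl, pointSL_generic, pointSL_generic]
  -- The inverse of `z` is the function `x ↦ z(x⁻¹)`.
  have hz : IsUnit z := by
    have h2 := hmul' (CoordSL L 2) (genericSL L 2) (genericSL L 2).adjugate (det_genericSL L 2)
      (by rw [det_adjugate, det_genericSL, one_pow])
    have h3 : pointSL (L := L) (genericSL L 2) (det_genericSL L 2) z = z := by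
      have : pointSL (L := L) (genericSL L 2) (det_genericSL L 2) = AlgHom.id L _ :=
        algHom_ext_coordSL fun i k => pointSL_generic _ _ _ _
      rw [this, AlgHom.id_apply]
    have h4 := congrArg (algebraMap L (CoordSL L 2)) h1
    have h5 : algebraMap L (CoordSL L 2) (pointSL (1 : Matrix (Fin 2) (Fin 2) L) det_one z) =
        pointSL (L := L) (genericSL L 2 * (genericSL L 2).adjugate)
          (by rw [mul_adjugate, det_genericSL, one_smul, det_one]) z := by
      refine DFunLike.congr_fun (f := (Algebra.ofId L (CoordSL L 2)).comp
        (pointSL (1 : Matrix (Fin 2) (Fin 2) L) det_one)) (algHom_ext_coordSL fun i k => ?_) z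
      rw [AlgHom.comp_apply, pointSL_generic, pointSL_generic, mul_adjugate, det_genericSL,
        one_smul, one_apply, one_apply]
      split_ifs <;> simp
    rw [h5, map_one, h2, h3] at h4
    exact IsUnit.of_mul_eq_one _ h4
  have hup : ∀ (K : Type u) [Field K] [Algebra L K] (t : K),
      pointSL (L := L) !![1, t; 0, 1] (by simp [det_fin_two]) z = 1 := by
    intro K _ _ t
    have h2 := pointSL_curve_eq_one hz h1 !![1, Polynomial.X; 0, 1] (by simp [det_fin_two]) (by
      ext i j; fin_cases i <;> fin_cases j <;> simp)
    have h3 := congrArg (Polynomial.aeval t) h2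
    rw [map_one, ← AlgHom.comp_apply, comp_pointSL _ _ _ (det_map_eq_one _ (by simp))] at h3
    refine Eq.trans ?_ h3
    congr 2
    ext i j; fin_cases i <;> fin_cases j <;> simp
  have hlow : ∀ (K : Type u) [Field K] [Algebra L K] (t : K),
      pointSL (L := L) !![1, 0; t, 1] (by simp [det_fin_two]) z = 1 := by
    intro K _ _ t
    have h2 := pointSL_curve_eq_one hz h1 !![1, 0; Polynomial.X, 1] (by simp [det_fin_two]) (by
      ext i j; fin_cases i <;> fin_cases j <;> simp)
    have h3 := congrArg (Polynomial.aeval t) h2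
    rw [map_one, ← AlgHom.comp_apply, comp_pointSL _ _ _ (det_map_eq_one _ (by simp))] at h3
    refine Eq.trans ?_ h3
    congr 2
    ext i j; fin_cases i <;> fin_cases j <;> simp
  have hc : genericSL L 2 1 0 ≠ 0 := by
    intro h0
    have := congrArg (pointSL (L := L) !![(1 : L), 0; 1, 1] (by simp [det_fin_two])) h0
    rw [pointSL_generic] at this
    simp at this
  -- Over the fraction field the generic matrix is a product of three unipotent matrices.
  let K := FractionRing (CoordSL L 2)
  have hinj : Function.Injective (algebraMap (CoordSL L 2) K) := IsFractionRing.injective _ _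
  let φ : CoordSL L 2 →ₐ[L] K := IsScalarTower.toAlgHom L _ _
  have hφ : ∀ x, φ x = algebraMap (CoordSL L 2) K x := fun _ => rfl
  set g := (genericSL L 2).map φ with hg
  have hgdet : g.det = 1 := det_map_eq_one _ (det_genericSL L 2)
  have hφz : φ z = pointSL (L := L) g hgdet z := by
    have : φ = pointSL (L := L) g hgdet := algHom_ext_coordSL fun i j => by
      rw [pointSL_generic, hg, Matrix.map_apply]
    rw [← this]
  have hc' : g 1 0 ≠ 0 := by
    rw [hg, Matrix.map_apply, hφ]
    exact fun h0 => hc (hinj (by rw [h0, map_zero]))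
  have hdec : g = !![1, (g 0 0 - 1) / g 1 0; 0, 1] * !![1, 0; g 1 0, 1] *
      !![1, (g 1 1 - 1) / g 1 0; 0, 1] := by
    conv_lhs => rw [eta_fin_two g]
    exact eq_mul_unipotent hc' (by rwa [det_fin_two] at hgdet)
  apply hinj
  rw [← hφ, hφz, map_one]
  have h2 : pointSL (L := L) g hgdet z = pointSL (L := L)
      (!![1, (g 0 0 - 1) / g 1 0; 0, 1] * !![1, 0; g 1 0, 1] *
      !![1, (g 1 1 - 1) / g 1 0; 0, 1]) (by rw [← hdec]; exact hgdet) z := by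
    congr 2
  rw [h2, hmul' K _ _ (by simp) (by simp), hmul' K _ _ (by simp) (by simp),
    hup, hlow, hup, one_mul, one_mul]

end GLn

/-! ### Linear independence of group-like elements over a subalgebra -/

section GroupLike

open Algebra.TensorProduct (map includeRight)

variable {L : Type*} [Field L] {B H : Type*} [CommRing B] [Algebra L B] [CommRing H]
  [Algebra L H] (j : B →ₐ[L] H)

theorem exists_mkQ_exact :
    Function.Exact j.toLinearMap (LinearMap.range j.toLinearMap).mkQ := by
  rw [LinearMap.exact_iff, Submodule.ker_mkQ]

/-- `(B ⊗ H) / (B ⊗ B)` is a free `B`-module, hence torsion-free. -/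
theorem mem_range_of_tmul_mul_mem [IsDomain B] {b : B} (hb : b ≠ 0) {z : B ⊗[L] H}
    (hz : (b ⊗ₜ[L] (1 : H)) * z ∈ (map (AlgHom.id L B) j).range) :
    z ∈ (map (AlgHom.id L B) j).range := by
  set q := (LinearMap.range j.toLinearMap).mkQ
  have hex := lTensor_exact B (exists_mkQ_exact j) (Submodule.mkQ_surjective _)
  have hmem : ∀ x, x ∈ (map (AlgHom.id L B) j).range ↔ q.lTensor B x = 0 := by
    intro x
    rw [hex x]
    rfl
  have hlin : ∀ x : B ⊗[L] H, q.lTensor B ((b ⊗ₜ[L] (1 : H)) * x) = b • q.lTensor B x := by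
    intro x
    induction x with
    | zero => simp
    | add x y hx hy => rw [mul_add, map_add, map_add, smul_add, hx, hy]
    | tmul c h => simp [TensorProduct.smul_tmul']
  rw [hmem] at hz ⊢
  rw [hlin] at hz
  exact (smul_eq_zero_iff_right hb).1 hz

theorem mem_range_of_tmul_mem {b : B} (hb : b ≠ 0) {h : H}
    (hz : b ⊗ₜ[L] h ∈ (map (AlgHom.id L B) j).range) : h ∈ j.range := by
  obtain ⟨μ, hμ⟩ := Module.Projective.exists_dual_ne_zero L hb
  obtain ⟨y, hy⟩ := hz
  have h1 : ∀ y : B ⊗[L] B, TensorProduct.lid L H (μ.rTensor H (map (AlgHom.id L B) j y)) ∈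
      LinearMap.range j.toLinearMap := by
    intro y
    induction y with
    | zero => simp
    | add x y hx hy => rw [map_add, map_add, map_add]; exact Submodule.add_mem _ hx hy
    | tmul c d => exact ⟨μ c • d, by simp⟩
  have h2 := h1 y
  have h3 : map (AlgHom.id L B) j y = b ⊗ₜ[L] h := hy
  rw [h3, LinearMap.rTensor_tmul, TensorProduct.lid_tmul, Submodule.smul_mem_iff _ hμ] at h2
  exact h2

/-- The map `b ⊗ h ↦ μ(h) b`. -/
noncomputable def sliceRight (B : Type*) [CommRing B] [Algebra L B] (μ : H →ₗ[L] L) :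
    B ⊗[L] H →ₗ[L] B :=
  (TensorProduct.rid L B).toLinearMap ∘ₗ μ.lTensor B

@[simp] theorem sliceRight_tmul (μ : H →ₗ[L] L) (b : B) (h : H) :
    sliceRight B μ (b ⊗ₜ[L] h) = μ h • b := by
  simp [sliceRight]

theorem sliceRight_mul (μ : H →ₗ[L] L) (b : B) (x : B ⊗[L] H) :
    sliceRight B μ ((b ⊗ₜ[L] 1) * x) = b * sliceRight B μ x := by
  induction x with
  | zero => simp
  | add x y hx hy => rw [mul_add, map_add, map_add, mul_add, hx, hy]
  | tmul c h => simp

theorem eq_of_sliceRight_eq {x y : B ⊗[L] H}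
    (hxy : ∀ μ : H →ₗ[L] L, sliceRight B μ x = sliceRight B μ y) : x = y := by
  classical
  apply (TensorProduct.equivFinsuppOfBasisRight (M := B)
    (Module.Basis.ofVectorSpace L H)).injective
  ext i
  rw [TensorProduct.equivFinsuppOfBasisRight_apply, TensorProduct.equivFinsuppOfBasisRight_apply]
  exact hxy _

/-- Let `B ⊆ H` be a sub-bialgebra which is a domain. Group-like elements of `H` no two of which
differ by a factor from `B` are linearly independent over `B`.

Here `δ` is the comultiplication of `B` with values in `B ⊗ H`, and `β` is the endomorphism
`b ⊗ h ↦ ∑ b₁ ⊗ S(b₂) h` of `B ⊗ H`. In a shortest relation the coefficients `a i` satisfy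
`(a i ⊗ 1) δ(a k) (1 ⊗ χ k) = (a k ⊗ 1) δ(a i) (1 ⊗ χ i)`, whence `δ(a k) (1 ⊗ χ k / χ i)` lies in
`B ⊗ B`, and so does its image `a k ⊗ χ k / χ i` under `β`. -/
theorem coeff_eq_zero_of_groupLike [IsDomain B] (Δ : H →ₐ[L] H ⊗[L] H) (δ : B →ₐ[L] B ⊗[L] H)
    (β : B ⊗[L] H →ₐ[L] B ⊗[L] H) (hj : Function.Injective j)
    (hδ : ∀ b, Δ (j b) = map j (AlgHom.id L H) (δ b))
    (hδB : ∀ b, δ b ∈ (map (AlgHom.id L B) j).range)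
    (hβδ : ∀ b, β (δ b) = b ⊗ₜ 1) (hβH : ∀ h, β (1 ⊗ₜ h) = 1 ⊗ₜ h)
    (hβB : ∀ x, β (map (AlgHom.id L B) j x) ∈ (map (AlgHom.id L B) j).range)
    {κ : Type*} (χ : κ → Hˣ) (hχ : ∀ k, Δ (χ k) = (χ k : H) ⊗ₜ (χ k : H))
    (hne : ∀ i k, i ≠ k → ((χ k * (χ i)⁻¹ : Hˣ) : H) ∉ j.range)
    (s : Finset κ) (a : κ → B) (ha : ∑ i ∈ s, j (a i) * χ i = 0) : ∀ i ∈ s, a i = 0 := by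
  classical
  induction s using Finset.induction_on generalizing a with
  | empty => simp
  | insert i s hi ih =>
    have hcontr : ∀ (μ : H →ₗ[L] L) (c : H) (x : B ⊗[L] H),
        sliceRight H μ (map j (AlgHom.id L H) x * (c ⊗ₜ c)) =
          j (sliceRight B μ (x * (1 ⊗ₜ c))) * c := by
      intro μ c x
      induction x with
      | zero => simp
      | add x y hx hy => simp only [map_add, add_mul, hx, hy]
      | tmul b h => simp
    let r : (H →ₗ[L] L) → κ → B := fun μ k => sliceRight B μ (δ (a k) * (1 ⊗ₜ (χ k : H)))
    have hr : ∀ μ, ∑ k ∈ insert i s, j (r μ k) * χ k = 0 := by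
      intro μ
      have h1 := congrArg (fun x => sliceRight H μ (Δ x)) ha
      simp only [map_sum, map_mul, hδ, hχ, hcontr, map_zero] at h1
      exact h1
    have hcross : ∀ k ∈ s, ∀ μ, a i * r μ k = a k * r μ i := by
      intro k hk μ
      have h1 : ∑ k ∈ s, j (a i * r μ k - a k * r μ i) * χ k = 0 := by
        have h2 : ∑ k ∈ insert i s, j (a i * r μ k - a k * r μ i) * χ k =
            j (a i) * (∑ k ∈ insert i s, j (r μ k) * χ k) -
              j (r μ i) * ∑ k ∈ insert i s, j (a k) * χ k := by
          rw [Finset.mul_sum, Finset.mul_sum, ← Finset.sum_sub_distrib]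
          refine Finset.sum_congr rfl fun k _ => ?_
          simp only [map_sub, map_mul]
          ring
        rw [hr, ha, Finset.sum_insert hi, sub_self, map_zero, zero_mul, zero_add, mul_zero,
          mul_zero, sub_zero] at h2
        exact h2
      exact sub_eq_zero.1 (ih _ h1 k hk)
    by_cases hai : a i = 0
    · rw [Finset.sum_insert hi, hai, map_zero, zero_mul, zero_add] at ha
      intro k hk
      rcases Finset.mem_insert.1 hk with rfl | hk
      · exact hai
      · exact ih a ha k hk
    have has : ∀ k ∈ s, a k = 0 := by
      intro k hk
      by_contra hak
      have h1 : (a i ⊗ₜ[L] (1 : H)) * (δ (a k) * (1 ⊗ₜ (χ k : H))) =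
          (a k ⊗ₜ[L] 1) * (δ (a i) * (1 ⊗ₜ (χ i : H))) :=
        eq_of_sliceRight_eq fun μ => by
          rw [sliceRight_mul, sliceRight_mul]; exact hcross k hk μ
      have h2 : (a i ⊗ₜ[L] (1 : H)) * (δ (a k) * (1 ⊗ₜ ((χ k * (χ i)⁻¹ : Hˣ) : H))) =
          (a k ⊗ₜ[L] 1) * δ (a i) := by
        have h3 := congrArg (· * ((1 : B) ⊗ₜ[L] (((χ i)⁻¹ : Hˣ) : H))) h1
        simpa [mul_assoc, ← Algebra.TensorProduct.one_def] using h3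
      have h4 : δ (a k) * (1 ⊗ₜ ((χ k * (χ i)⁻¹ : Hˣ) : H)) ∈ (map (AlgHom.id L B) j).range := by
        refine mem_range_of_tmul_mul_mem j hai ?_
        rw [h2]
        exact mul_mem ⟨a k ⊗ₜ 1, by simp⟩ (hδB _)
      obtain ⟨y, hy⟩ := h4
      have h5 := hβB y
      have h6 : map (AlgHom.id L B) j y = _ := hy
      rw [h6, map_mul, hβδ, hβH, Algebra.TensorProduct.tmul_mul_tmul, mul_one, one_mul] at h5
      exact hne i k (fun h => hi (h ▸ hk)) (mem_range_of_tmul_mem j hak h5)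
    rw [Finset.sum_insert hi, Finset.sum_eq_zero fun k hk => by rw [has k hk, map_zero, zero_mul],
      add_zero, Units.mul_left_eq_zero] at ha
    exact absurd (hj (by rw [ha, map_zero])) hai

end GroupLike

/-! ### Group-like elements over the coordinate ring of `SL(2)` -/

namespace GLn

open Matrix
open Algebra.TensorProduct (includeLeft includeRight)

variable {L : Type u} [Field L]

variable {H : Type v} [CommRing H] [HopfAlgebra L H] {v : Matrix (Fin 2) (Fin 2) H}

/-- If `v` is multiplicative, the comultiplication of `H` restricts to that of `SL(2)`. -/
theorem comul_pointSL (hv : v.det = 1)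
    (hΔ : ∀ i k, Coalgebra.comul (R := L) (v i k) = ∑ l, v i l ⊗ₜ[L] v l k) (b : CoordSL L 2) :
    Bialgebra.comulAlgHom L H (pointSL v hv b) =
      Algebra.TensorProduct.map (pointSL v hv) (AlgHom.id L H)
        (pointSL (L := L) (tensorMul (genericSL L 2) v)
          (det_tensorMul (det_genericSL L 2) hv) b) := by
  rw [← AlgHom.comp_apply, ← AlgHom.comp_apply]
  congr 1
  refine algHom_ext_coordSL fun i k => ?_
  rw [AlgHom.comp_apply, AlgHom.comp_apply, pointSL_generic, pointSL_generic, tensorMul_apply,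
    map_sum]
  refine (hΔ i k).trans ?_
  refine Finset.sum_congr rfl fun l _ => ?_
  refine Eq.trans ?_ (Algebra.TensorProduct.map_tmul _ _ _ _).symm
  rw [pointSL_generic]
  rfl

/-- A group-like element of `H` that is a function on the quotient `SL(2)` of `Spec H` is trivial. -/
theorem eq_one_of_groupLike_mem_range (hv : v.det = 1)
    (hΔ : ∀ i k, Coalgebra.comul (R := L) (v i k) = ∑ l, v i l ⊗ₜ[L] v l k)
    (hε : ∀ i k, Coalgebra.counit (R := L) (v i k) = if i = k then 1 else 0)
    (hinj : Function.Injective (pointSL (L := L) v hv)) {ψ : H}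
    (hψ : IsGroupLikeElem L ψ) (hr : ψ ∈ (pointSL (L := L) v hv).range) : ψ = 1 := by
  obtain ⟨z, rfl⟩ := hr
  change pointSL v hv z = 1
  rw [eq_one_of_multiplicative (z := z), map_one]
  · have h1 : (Bialgebra.counitAlgHom L H).comp (pointSL v hv) =
        pointSL (1 : Matrix (Fin 2) (Fin 2) L) det_one := algHom_ext_coordSL fun i k => by
      rw [AlgHom.comp_apply, pointSL_generic, pointSL_generic, one_apply]
      exact hε i k
    rw [← h1]
    exact hψ.counit_eq_one
  · have hinj2 : Function.Injective
        (Algebra.TensorProduct.map (pointSL (L := L) v hv) (pointSL (L := L) v hv)) :=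
      TensorProduct.map_injective_of_flat_flat _ _ hinj hinj
    apply hinj2
    refine Eq.trans ?_ (Algebra.TensorProduct.map_tmul _ _ _ _).symm
    refine Eq.trans ?_ hψ.comul_eq_tmul_self
    have h1 := comul_pointSL hv hΔ z
    refine Eq.trans ?_ h1.symm
    rw [← AlgHom.comp_apply, ← AlgHom.comp_apply]
    congr 1
    refine algHom_ext_coordSL fun i k => ?_
    rw [AlgHom.comp_apply, AlgHom.comp_apply, pointSL_generic, pointSL_generic, tensorMul_apply,
      tensorMul_apply, map_sum, map_sum]
    refine Finset.sum_congr rfl fun l _ => ?_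
    refine (Algebra.TensorProduct.map_tmul _ _ _ _).trans
      (Eq.trans ?_ (Algebra.TensorProduct.map_tmul _ _ _ _).symm)
    rw [pointSL_generic, pointSL_generic]
    rfl

/-- Distinct group-like elements of `H` are linearly independent over the functions on the quotient
`SL(2)` of `Spec H`. -/
theorem coeff_eq_zero_of_groupLike_SL (hv : v.det = 1)
    (hΔ : ∀ i k, Coalgebra.comul (R := L) (v i k) = ∑ l, v i l ⊗ₜ[L] v l k)
    (hε : ∀ i k, Coalgebra.counit (R := L) (v i k) = if i = k then 1 else 0)
    (hinj : Function.Injective (pointSL (L := L) v hv)) {κ : Type*} (χ : κ → Hˣ)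
    (hχ : ∀ k, IsGroupLikeElem L (χ k : H)) (hχinj : Function.Injective χ)
    (s : Finset κ) (a : κ → CoordSL L 2) (ha : ∑ i ∈ s, pointSL (L := L) v hv (a i) * χ i = 0) :
    ∀ i ∈ s, a i = 0 := by
  have hvadj : v.adjugate.det = 1 := by rw [det_adjugate, hv, one_pow]
  have hxadj : (genericSL L 2).adjugate.det = 1 := by
    rw [det_adjugate, det_genericSL, one_pow]
  set j := pointSL (L := L) v hv with hj
  have hjx : ∀ i k, j (genericSL L 2 i k) = v i k := pointSL_generic v hv
  have hjxadj : ∀ i k, j ((genericSL L 2).adjugate i k) = v.adjugate i k :=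
    pointSL_adjugate v hv
  have hmap : ∀ (y : Matrix (Fin 2) (Fin 2) (CoordSL L 2)) (hy : y.det = 1)
      (y' : Matrix (Fin 2) (Fin 2) H) (hy' : y'.det = 1) (h : ∀ i k, j (y i k) = y' i k) b,
      pointSL (L := L) (tensorMul (genericSL L 2) y') (det_tensorMul (det_genericSL L 2) hy') b =
      Algebra.TensorProduct.map (AlgHom.id L (CoordSL L 2)) j
        (pointSL (L := L) (tensorMul (genericSL L 2) y)
          (det_tensorMul (det_genericSL L 2) hy) b) := by
    intro y hy y' hy' h b
    rw [← AlgHom.comp_apply]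
    congr 1
    refine algHom_ext_coordSL fun i k => ?_
    rw [AlgHom.comp_apply, pointSL_generic, pointSL_generic, tensorMul_apply, tensorMul_apply,
      map_sum]
    refine Finset.sum_congr rfl fun l _ => ?_
    refine Eq.trans ?_ (Algebra.TensorProduct.map_tmul _ _ _ _).symm
    rw [h]
    rfl
  let β : CoordSL L 2 ⊗[L] H →ₐ[L] CoordSL L 2 ⊗[L] H := Algebra.TensorProduct.lift
    (pointSL (L := L) (tensorMul (genericSL L 2) v.adjugate)
      (det_tensorMul (det_genericSL L 2) hvadj)) includeRight fun _ _ => mul_comm _ _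
  have hβ : ∀ b h, β (b ⊗ₜ h) = pointSL (L := L) (tensorMul (genericSL L 2) v.adjugate)
      (det_tensorMul (det_genericSL L 2) hvadj) b * (1 ⊗ₜ h) := fun b h =>
    Algebra.TensorProduct.lift_tmul _ _ _ _ _
  -- `β` is the translation `x ↦ x v⁻¹` on `SL(2)`, with functions on `Spec H` as constants.
  refine coeff_eq_zero_of_groupLike j (Bialgebra.comulAlgHom L H)
    (pointSL (L := L) (tensorMul (genericSL L 2) v) (det_tensorMul (det_genericSL L 2) hv)) β hinj
    (comul_pointSL hv hΔ) (fun b => ⟨_, (hmap _ (det_genericSL L 2) v hv hjx b).symm⟩)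
    (fun b => ?_) (fun h => by rw [hβ, map_one, one_mul]) (fun x => ?_) χ
    (fun k => (hχ k).comul_eq_tmul_self) (fun i k hik hmem => ?_) s a ha
  · have h1 : β.comp (pointSL (L := L) (tensorMul (genericSL L 2) v)
        (det_tensorMul (det_genericSL L 2) hv)) = includeLeft := by
      refine algHom_ext_coordSL fun i k => ?_
      rw [AlgHom.comp_apply, pointSL_generic, tensorMul_apply, map_sum]
      have h2 : ∀ l, β (genericSL L 2 i l ⊗ₜ v l k) =
          ∑ l', genericSL L 2 i l' ⊗ₜ (v.adjugate l' l * v l k) := by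
        intro l
        rw [hβ, pointSL_generic, tensorMul_apply, Finset.sum_mul]
        refine Finset.sum_congr rfl fun l' _ => ?_
        rw [Algebra.TensorProduct.tmul_mul_tmul, mul_one]
      simp only [h2]
      rw [Finset.sum_comm]
      simp only [← TensorProduct.tmul_sum, ← mul_apply, adjugate_mul, hv, one_smul]
      rw [Finset.sum_eq_single k (fun l _ hl => by rw [one_apply_ne hl, TensorProduct.tmul_zero])
        (by simp), one_apply_eq]
      rfl
    exact DFunLike.congr_fun h1 b
  · induction x with
    | zero => rw [map_zero, map_zero]; exact zero_mem _
    | add x y hx hy => rw [map_add, map_add]; exact add_mem hx hy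
    | tmul b c =>
      have h1 : Algebra.TensorProduct.map (AlgHom.id L (CoordSL L 2)) j (b ⊗ₜ c) = b ⊗ₜ j c :=
        Algebra.TensorProduct.map_tmul _ _ _ _
      rw [h1, hβ, hmap _ hxadj _ hvadj hjxadj]
      refine mul_mem ⟨_, rfl⟩ ⟨1 ⊗ₜ c, ?_⟩
      refine (Algebra.TensorProduct.map_tmul _ _ _ _).trans ?_
      rw [map_one]
  · have h1 : IsGroupLikeElem L ((χ k * (χ i)⁻¹ : Hˣ) : H) := by
      rw [Units.val_mul]
      exact (hχ k).mul (hχ i).unitsInv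
    have h2 := eq_one_of_groupLike_mem_range hv hΔ hε hinj h1 hmem
    rw [Units.val_eq_one, mul_inv_eq_one] at h2
    exact hik (hχinj h2.symm)

end GLn

/-! ### The closed subgroup schemes `SL(2) · μ_k` -/

namespace GLn

open Matrix
open Algebra.TensorProduct (includeLeft includeRight)

variable {L : Type u} [Field L]

section

variable {A : Type*} [CommRing A] [Algebra L A] {k : ℕ}

/-- The homomorphism `ℤ / k → Aˣ`, `1 ↦ t`, for a unit `t` with `t ^ k = 1`. -/
def zmodPow (t : Aˣ) (ht : t ^ k = 1) : ZMod k →+ Additive Aˣ :=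
  ZMod.lift k ⟨zmultiplesHom (Additive Aˣ) (Additive.ofMul t), by
    rw [zmultiplesHom_apply, natCast_zsmul, ← ofMul_pow, ht, ofMul_one]⟩

theorem zmodPow_one (t : Aˣ) (ht : t ^ k = 1) : (zmodPow t ht 1).toMul = t := by
  have h := ZMod.lift_coe k ⟨zmultiplesHom (Additive Aˣ) (Additive.ofMul t), by
    rw [zmultiplesHom_apply, natCast_zsmul, ← ofMul_pow, ht, ofMul_one]⟩ 1
  rw [Int.cast_one] at h
  change Additive.toMul (ZMod.lift k _ 1) = t
  rw [h]
  simp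

theorem zmodPow_eq (t : Aˣ) (ht : t ^ k = 1) (i : ZMod k) :
    ∃ m : ℤ, (zmodPow t ht i).toMul = t ^ m := by
  obtain ⟨m, rfl⟩ := ZMod.intCast_surjective i
  refine ⟨m, ?_⟩
  change Additive.toMul (ZMod.lift k _ m) = _
  rw [ZMod.lift_coe]
  simp

theorem zmodPow_orderOf_injective (t : Aˣ) :
    Function.Injective (zmodPow t (pow_orderOf_eq_one t)) := by
  refine (ZMod.lift_injective _).2 fun m hm => ?_
  rw [ZMod.intCast_zmod_eq_zero_iff_dvd]
  rw [orderOf_dvd_iff_zpow_eq_one]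
  have h : m • Additive.ofMul t = 0 := by simpa using hm
  exact h

/-- The `A`-point of `μ_k` given by a unit `t` with `t ^ k = 1`. -/
noncomputable def pointMu (t : Aˣ) (ht : t ^ k = 1) : CoordMu L k →ₐ[L] A :=
  AddMonoidAlgebra.lift L A (ZMod k) ((Units.coeHom A).comp (zmodPow t ht).toMultiplicativeLeft)

theorem pointMu_single (t : Aˣ) (ht : t ^ k = 1) (i : ZMod k) :
    pointMu (L := L) t ht (AddMonoidAlgebra.single i 1 : AddMonoidAlgebra L (ZMod k)) =
      ((zmodPow t ht i).toMul : A) := by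
  refine (AddMonoidAlgebra.lift_single _ _ _).trans ?_
  rw [one_smul]
  rfl

theorem pointMu_generic (t : Aˣ) (ht : t ^ k = 1) :
    pointMu (L := L) t ht (genericMu L k) = (t : A) := by
  rw [genericMu, pointMu_single, zmodPow_one]

variable {n : ℕ}

/-- The `A`-point of `SL(n) × μ_k` given by a matrix `a` and a unit `t`. -/
noncomputable def pointSLMu (a : Matrix (Fin n) (Fin n) A) (ha : a.det = 1) (t : Aˣ)
    (ht : t ^ k = 1) : CoordSL L n ⊗[L] CoordMu L k →ₐ[L] A :=
  Algebra.TensorProduct.lift (pointSL a ha) (pointMu t ht) fun _ _ => mul_comm _ _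

theorem pointSLMu_tmul (a : Matrix (Fin n) (Fin n) A) (ha : a.det = 1) (t : Aˣ)
    (ht : t ^ k = 1) (x : CoordSL L n) (y : CoordMu L k) :
    pointSLMu a ha t ht (x ⊗ₜ y) = pointSL a ha x * pointMu t ht y :=
  Algebra.TensorProduct.lift_tmul _ _ _ _ _

theorem isUnit_det_smul {a : Matrix (Fin n) (Fin n) A} (ha : a.det = 1) (t : Aˣ) :
    IsUnit ((t : A) • a).det := by
  rw [det_smul, ha, mul_one]
  exact t.isUnit.pow _

theorem pointSLMu_comp (a : Matrix (Fin n) (Fin n) A) (ha : a.det = 1) (t : Aˣ)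
    (ht : t ^ k = 1) :
    (pointSLMu a ha t ht).comp (point (genericSLMu L n k) (isUnit_det_genericSLMu L n k)) =
      point (L := L) ((t : A) • a) (isUnit_det_smul ha t) :=
  algHom_ext_coord fun i j => by
    rw [AlgHom.comp_apply, point_algebraMap_X, point_algebraMap_X, genericSLMu, of_apply,
      pointSLMu_tmul, pointSL_generic, pointMu_generic, mul_comm]
    rfl

end

/-- When `k` is the order of the group-like element `χ`, the homomorphism `(v, χ)` from `Spec H` to
`SL(2) × μ_k` is dominant. -/
theorem pointSLMu_injective {H : Type v} [CommRing H] [HopfAlgebra L H]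
    {v : Matrix (Fin 2) (Fin 2) H} (hv : v.det = 1)
    (hΔ : ∀ i k, Coalgebra.comul (R := L) (v i k) = ∑ l, v i l ⊗ₜ[L] v l k)
    (hε : ∀ i k, Coalgebra.counit (R := L) (v i k) = if i = k then 1 else 0)
    (hinj : Function.Injective (pointSL (L := L) v hv)) (χ : Hˣ)
    (hχ : IsGroupLikeElem L (χ : H)) :
    Function.Injective (pointSLMu (L := L) v hv χ (pow_orderOf_eq_one χ)) := by
  classical
  rw [injective_iff_map_eq_zero]
  intro x hx
  let e := TensorProduct.equivFinsuppOfBasisRight (M := CoordSL L 2)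
    (AddMonoidAlgebra.basis (ZMod (orderOf χ)) L)
  obtain ⟨a, ha⟩ : ∃ a, x = e.symm a := ⟨e x, (e.symm_apply_apply x).symm⟩
  have hsum : x = ∑ i ∈ a.support, a i ⊗ₜ[L]
      (AddMonoidAlgebra.single i 1 : AddMonoidAlgebra L (ZMod (orderOf χ))) := by
    rw [ha, TensorProduct.equivFinsuppOfBasisRight_symm_apply, Finsupp.sum]
    refine Finset.sum_congr rfl fun i _ => ?_
    congr 1
  have hx2 : ∑ i ∈ a.support, pointSL (L := L) v hv (a i) *
      ((zmodPow χ (pow_orderOf_eq_one χ) i).toMul : H) = 0 := by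
    rw [← hx, hsum]
    refine Eq.trans ?_ (map_sum _ _ _).symm
    refine Finset.sum_congr rfl fun i _ => ?_
    refine Eq.trans ?_ (pointSLMu_tmul _ _ _ _ _ _).symm
    rw [pointMu_single]
  have hz := coeff_eq_zero_of_groupLike_SL hv hΔ hε hinj
    (fun i => (zmodPow χ (pow_orderOf_eq_one χ) i).toMul) (fun i => ?_)
    (fun i j hij => zmodPow_orderOf_injective χ hij) a.support a hx2
  · have : a = 0 := by
      ext i
      by_cases hi : i ∈ a.support
      · exact hz i hi
      · exact Finsupp.notMem_support_iff.1 hi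
    rw [ha, this]
    exact map_zero _
  · obtain ⟨m, hm⟩ := zmodPow_eq χ (pow_orderOf_eq_one χ) i
    rw [hm]
    cases m with
    | ofNat m => simpa using hχ.pow
    | negSucc m =>
      rw [zpow_negSucc]
      exact IsGroupLikeElem.unitsInv (by simpa using hχ.pow)

/-- If `v` identifies the functions on `SL(2)` with a subalgebra of `H`, the closed image of the
twist of `v` by a character `χ` of order `k` is `SL(2) · μ_k`; here `k = 0` stands for infinite
order and `μ_0` for the multiplicative group. -/
theorem ker_point_smul {H : Type v} [CommRing H] [HopfAlgebra L H]
    {v : Matrix (Fin 2) (Fin 2) H} (hv : v.det = 1)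
    (hΔ : ∀ i k, Coalgebra.comul (R := L) (v i k) = ∑ l, v i l ⊗ₜ[L] v l k)
    (hε : ∀ i k, Coalgebra.counit (R := L) (v i k) = if i = k then 1 else 0)
    (hinj : Function.Injective (pointSL (L := L) v hv)) (χ : Hˣ)
    (hχ : IsGroupLikeElem L (χ : H)) :
    RingHom.ker (point (L := L) ((χ : H) • v) (isUnit_det_smul hv χ)) =
      idealSLMu L 2 (orderOf χ) := by
  ext x
  rw [← pointSLMu_comp v hv χ (pow_orderOf_eq_one χ), idealSLMu, RingHom.mem_ker, RingHom.mem_ker,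
    AlgHom.comp_apply, map_eq_zero_iff _ (pointSLMu_injective hv hΔ hε hinj χ hχ)]

/-- The multiplication `SL(2) × G_m → GL(2)` is dominant: over an algebraically closed field
containing the entries of the generic matrix `x`, the matrix `x` is `r` times a matrix of determinant
`1`, where `r² = det x`. -/
theorem idealSLMu_zero : idealSLMu L 2 0 = ⊥ := by
  have hle : Submonoid.powers (genericDet L 2) ≤ nonZeroDivisors _ :=
    powers_le_nonZeroDivisors_of_noZeroDivisors (det_mvPolynomialX_ne_zero _ _)
  have hdom : IsDomain (Coord L 2) :=
    IsLocalization.isDomain_of_le_nonZeroDivisors (Coord L 2) hle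
  let E := AlgebraicClosure (FractionRing (Coord L 2))
  let φ : Coord L 2 →ₐ[L] E := IsScalarTower.toAlgHom L (Coord L 2) E
  have hφ : Function.Injective φ := by
    have h1 := (algebraMap (FractionRing (Coord L 2)) E).injective.comp
      (IsFractionRing.injective (Coord L 2) (FractionRing (Coord L 2)))
    rwa [← RingHom.coe_comp, ← IsScalarTower.algebraMap_eq] at h1
  let x : Matrix (Fin 2) (Fin 2) E := of fun i j =>
    φ (algebraMap (MvPolynomial (Fin 2 × Fin 2) L) (Coord L 2) (MvPolynomial.X (i, j)))
  obtain ⟨r, hr⟩ := IsAlgClosed.exists_pow_nat_eq x.det (n := 2) (by norm_num)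
  have hx0 : x.det ≠ 0 := by
    have h1 : x.det = φ (algebraMap _ (Coord L 2) (genericDet L 2)) := by
      rw [genericDet, RingHom.map_det, AlgHom.map_det]
      rfl
    rw [h1]
    exact ((IsLocalization.Away.algebraMap_isUnit (genericDet L 2)).map φ).ne_zero
  have hr0 : r ≠ 0 := by
    rintro rfl
    exact hx0 (by rw [← hr]; simp)
  have ha : (r⁻¹ • x).det = 1 := by
    rw [det_smul, ← hr, Fintype.card_fin, inv_pow, inv_mul_cancel₀ (pow_ne_zero 2 hr0)]
  have hcomp := pointSLMu_comp (L := L) (k := 0) (r⁻¹ • x) ha (Units.mk0 r hr0) (pow_zero _)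
  have hpt : point (L := L) (((Units.mk0 r hr0 : Eˣ) : E) • r⁻¹ • x) (isUnit_det_smul ha _) = φ := by
    refine algHom_ext_coord fun i j => ?_
    rw [point_algebraMap_X, Units.val_mk0, smul_smul, mul_inv_cancel₀ hr0, one_smul]
    rfl
  rw [hpt] at hcomp
  rw [eq_bot_iff]
  intro z hz
  rw [idealSLMu, RingHom.mem_ker] at hz
  refine hφ ?_
  rw [← hcomp, AlgHom.comp_apply, hz, map_zero, map_zero]

end GLn

/-! ### Conjugates and twists of the standard representation of `SL(2)` -/

namespace GLn

open Matrix

variable {L : Type u} [Field L]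

theorem map_conj_genericSL {A : Type*} [CommRing A] [Algebra L A] {n : ℕ}
    (φ : CoordSL L n →ₐ[L] A) (f g : Matrix (Fin n) (Fin n) L) (i j : Fin n) :
    φ ((g.map (algebraMap L (CoordSL L n)) * genericSL L n *
      f.map (algebraMap L (CoordSL L n))) i j) =
      (g.map (algebraMap L A) * (genericSL L n).map φ * f.map (algebraMap L A)) i j := by
  have hcst : ∀ f : Matrix (Fin n) (Fin n) L,
      (f.map (algebraMap L (CoordSL L n))).map φ = f.map (algebraMap L A) := by
    intro f
    ext i j
    simp
  rw [← hcst f, ← hcst g, ← Matrix.map_mul, ← Matrix.map_mul, Matrix.map_apply]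

/-- Conjugation by a constant matrix is an automorphism of `SL(n)`. -/
theorem pointSL_injective_of_conj {A : Type*} [CommRing A] [Algebra L A] {n : ℕ}
    {f g : Matrix (Fin n) (Fin n) L} (hfg : f * g = 1) {v v' : Matrix (Fin n) (Fin n) A}
    (hv : v.det = 1) (hv' : v'.det = 1)
    (h : v' = g.map (algebraMap L A) * v * f.map (algebraMap L A))
    (hinj : Function.Injective (pointSL (L := L) v hv)) :
    Function.Injective (pointSL (L := L) v' hv') := by
  have hgf : g * f = 1 := mul_eq_one_comm.1 hfg
  have hmap : ∀ {f g : Matrix (Fin n) (Fin n) L}, f * g = 1 →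
      f.map (algebraMap L (CoordSL L n)) * g.map (algebraMap L (CoordSL L n)) = 1 := by
    intro f g h
    rw [← Matrix.map_mul, h, Matrix.map_one _ (map_zero _) (map_one _)]
  have hdet : ∀ {f g : Matrix (Fin n) (Fin n) L}, f * g = 1 →
      (g.map (algebraMap L (CoordSL L n)) * genericSL L n *
        f.map (algebraMap L (CoordSL L n))).det = 1 := by
    intro f g h
    rw [det_mul, det_mul, det_genericSL, mul_one, mul_comm, ← det_mul, hmap h, det_one]
  let c : CoordSL L n →ₐ[L] CoordSL L n := pointSL _ (hdet hfg)
  let c' : CoordSL L n →ₐ[L] CoordSL L n := pointSL _ (hdet hgf)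
  have hcc : c'.comp c = AlgHom.id L _ := by
    refine algHom_ext_coordSL fun i j => ?_
    have h1 : (genericSL L n).map c' = f.map (algebraMap L (CoordSL L n)) * genericSL L n *
        g.map (algebraMap L (CoordSL L n)) := by
      ext i j
      exact pointSL_generic _ (hdet hgf) i j
    rw [AlgHom.comp_apply, pointSL_generic, map_conj_genericSL, h1, AlgHom.id_apply]
    simp only [mul_assoc, hmap hgf, mul_one]
    rw [← mul_assoc, hmap hgf, one_mul]
  have hvc : pointSL (L := L) v' hv' = (pointSL (L := L) v hv).comp c := by
    refine algHom_ext_coordSL fun i j => ?_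
    have h1 : (genericSL L n).map (pointSL (L := L) v hv) = v := by
      ext i j
      exact pointSL_generic _ hv i j
    rw [AlgHom.comp_apply, pointSL_generic, pointSL_generic, map_conj_genericSL, h1, h]
  rw [hvc]
  refine hinj.comp (Function.LeftInverse.injective (g := c') fun x => ?_)
  exact DFunLike.congr_fun hcc x

/-- The twisting factor between two matrix representations, the second of determinant `1`, is a
character. -/
theorem isGroupLikeElem_of_smul {H : Type v} [CommRing H] [HopfAlgebra L H]
    {v w : Matrix (Fin 2) (Fin 2) H} (hv : v.det = 1)
    (hvΔ : ∀ i k, Coalgebra.comul (R := L) (v i k) = ∑ l, v i l ⊗ₜ[L] v l k)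
    (hvε : ∀ i k, Coalgebra.counit (R := L) (v i k) = if i = k then 1 else 0)
    (hwΔ : ∀ i k, Coalgebra.comul (R := L) (w i k) = ∑ l, w i l ⊗ₜ[L] w l k)
    (hwε : ∀ i k, Coalgebra.counit (R := L) (w i k) = if i = k then 1 else 0)
    {χ : H} (hχ : w = χ • v) : IsGroupLikeElem L χ where
  counit_eq_one := by
    have h := hwε 0 0
    rw [hχ, Matrix.smul_apply, smul_eq_mul, Bialgebra.counit_mul, hvε] at h
    simpa using h
  comul_eq_tmul_self := by
    have h1 : ∀ i k, Coalgebra.comul (R := L) χ * Coalgebra.comul (R := L) (v i k) =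
        (χ ⊗ₜ[L] χ) * Coalgebra.comul (R := L) (v i k) := by
      intro i k
      rw [← Bialgebra.comul_mul, ← smul_eq_mul (a := χ), ← Matrix.smul_apply, ← hχ, hwΔ, hvΔ,
        Finset.mul_sum]
      refine Finset.sum_congr rfl fun l _ => ?_
      rw [hχ, Algebra.TensorProduct.tmul_mul_tmul]
      rfl
    have h2 : Coalgebra.comul (R := L) (1 : H) =
        Coalgebra.comul (R := L) (v 0 0) * Coalgebra.comul (R := L) (v 1 1) -
          Coalgebra.comul (R := L) (v 0 1) * Coalgebra.comul (R := L) (v 1 0) := by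
      rw [← Bialgebra.comul_mul, ← Bialgebra.comul_mul, ← map_sub, ← det_fin_two, hv]
    rw [Bialgebra.comul_one] at h2
    calc Coalgebra.comul (R := L) χ = Coalgebra.comul (R := L) χ * 1 := (mul_one _).symm
      _ = (χ ⊗ₜ[L] χ) * 1 := by
        rw [h2, mul_sub, mul_sub, ← mul_assoc, ← mul_assoc, h1, h1, mul_assoc, mul_assoc]
      _ = _ := mul_one _

end GLn

/-! ### Representations in coordinates -/

namespace GRep

open Matrix

variable {L : Type u} {H : Type v} [Field L] [CommRing H] [HopfAlgebra L H]

theorem sum_tmul_eq_iff {κ M A : Type*} [Fintype κ] [AddCommGroup M] [Module L M] [AddCommGroup A]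
    [Module L A] (b : Module.Basis κ L M) (x y : κ → A) :
    ∑ i, b i ⊗ₜ[L] x i = ∑ i, b i ⊗ₜ[L] y i ↔ x = y := by
  classical
  refine ⟨fun h => ?_, fun h => by rw [h]⟩
  ext i
  have h1 := congrArg (fun z => TensorProduct.lid L A ((b.coord i).rTensor A z)) h
  simpa [Finsupp.single_apply] using h1

/-- A linear map is compatible with coactions if and only if its matrix intertwines the matrices of
coefficients. -/
theorem coaction_comm_iff {κ κ' M N A : Type*} [Fintype κ] [DecidableEq κ] [Fintype κ']
    [AddCommGroup M] [Module L M] [AddCommGroup N] [Module L N] [CommRing A] [Algebra L A]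
    {ρM : M →ₗ[L] M ⊗[L] A} {ρN : N →ₗ[L] N ⊗[L] A}
    (b : Module.Basis κ L M) (c : Module.Basis κ' L N) {a : Matrix κ κ A} {a' : Matrix κ' κ' A}
    (ha : ∀ j, ρM (b j) = ∑ i, b i ⊗ₜ[L] a i j) (ha' : ∀ j, ρN (c j) = ∑ i, c i ⊗ₜ[L] a' i j)
    (T : M →ₗ[L] N) :
    ρN ∘ₗ T = T.rTensor A ∘ₗ ρM ↔
      a' * (LinearMap.toMatrix b c T).map (algebraMap L A) =
        (LinearMap.toMatrix b c T).map (algebraMap L A) * a := by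
  have hT : ∀ j, T (b j) = ∑ i, LinearMap.toMatrix b c T i j • c i := fun j => by
    simp [LinearMap.toMatrix_apply, c.sum_repr]
  have h1 : ∀ j, ρN (T (b j)) =
      ∑ i, c i ⊗ₜ[L] (a' * (LinearMap.toMatrix b c T).map (algebraMap L A)) i j := by
    intro j
    simp only [hT, map_sum, map_smul, ha', mul_apply, TensorProduct.tmul_sum, Matrix.map_apply,
      Finset.smul_sum]
    rw [Finset.sum_comm]
    refine Finset.sum_congr rfl fun i _ => Finset.sum_congr rfl fun k _ => ?_
    rw [mul_comm, ← Algebra.smul_def, TensorProduct.tmul_smul]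
  have h2 : ∀ j, T.rTensor A (ρM (b j)) =
      ∑ i, c i ⊗ₜ[L] ((LinearMap.toMatrix b c T).map (algebraMap L A) * a) i j := by
    intro j
    simp only [ha, map_sum, LinearMap.rTensor_tmul, hT, mul_apply, TensorProduct.tmul_sum,
      Matrix.map_apply, TensorProduct.sum_tmul]
    rw [Finset.sum_comm]
    refine Finset.sum_congr rfl fun i _ => Finset.sum_congr rfl fun k _ => ?_
    rw [← Algebra.smul_def, TensorProduct.tmul_smul, TensorProduct.smul_tmul']
  constructor
  · intro h
    ext i j
    have h3 := LinearMap.congr_fun h (b j)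
    rw [LinearMap.comp_apply, LinearMap.comp_apply, h1, h2, sum_tmul_eq_iff] at h3
    exact congrFun h3 i
  · intro h
    refine b.ext fun j => ?_
    rw [LinearMap.comp_apply, LinearMap.comp_apply, h1, h2, h]

theorem piTensor_ρ_basis {ι : Type} [Fintype ι] [DecidableEq ι] (V : ι → GRep L H)
    (b : ∀ i, Module.Basis (Fin 2) L (V i)) (q : ι → Fin 2) :
    (piTensor V).ρ (Basis.piTensorProduct b q) =
      ∑ p, Basis.piTensorProduct b p ⊗ₜ[L] kron (fun i => (V i).coeffMatrix (b i)) p q := by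
  rw [Basis.piTensorProduct_apply]
  change piMulRight (fun i => (V i : Type u)) H
    (PiTensorProduct.map (fun i => (V i).ρ) (PiTensorProduct.tprod L fun i => b i (q i))) = _
  rw [PiTensorProduct.map_tprod]
  simp only [ρ_basis]
  rw [MultilinearMap.map_sum, map_sum]
  refine Finset.sum_congr rfl fun p _ => ?_
  rw [piMulRight_tprod, Basis.piTensorProduct_apply, kron_apply]

/-- The one-dimensional representation given by a group-like element. -/
def character {χ : H} (hχ : IsGroupLikeElem L χ) : GRep L H where
  carrier := L
  ρ := (TensorProduct.mk L L H).flip χ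
  coassoc := by
    ext
    simp [hχ.comul_eq_tmul_self]
  counit := by
    ext
    simp [hχ.counit_eq_one]

/-- A linear isomorphism that intertwines `W` with the twist of `V` by a character `χ`, as an
isomorphism of representations. -/
def isoTensorCharacter {V W : GRep L H} {χ : H} (hχ : IsGroupLikeElem L χ) (e : W ≃ₗ[L] V)
    (he : ((LinearMap.mulRight L χ).lTensor V ∘ₗ V.ρ) ∘ₗ e.toLinearMap =
      e.toLinearMap.rTensor H ∘ₗ W.ρ) : W.Iso (V.tensor (character hχ)) where
  toLinearEquiv := e ≪≫ₗ (TensorProduct.rid L V).symm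
  comm := by
    have h1 : ∀ z : V ⊗[L] H, mulRight V L H (z ⊗ₜ[L] ((1 : L) ⊗ₜ[L] χ)) =
        (TensorProduct.rid L V).symm.toLinearMap.rTensor H
          ((LinearMap.mulRight L χ).lTensor V z) := by
      intro z
      induction z with
      | zero => simp
      | add x y hx hy => rw [TensorProduct.add_tmul, map_add, map_add, map_add, hx, hy]
      | tmul v h => simp
    refine LinearMap.ext fun w => ?_
    have h2 := LinearMap.congr_fun he w
    simp only [LinearMap.comp_apply, LinearEquiv.coe_coe] at h2
    have h3 : ∀ y, (e ≪≫ₗ (TensorProduct.rid L V).symm).toLinearMap.rTensor H y =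
        (TensorProduct.rid L V).symm.toLinearMap.rTensor H (e.toLinearMap.rTensor H y) := fun y => by
      rw [← LinearMap.comp_apply, ← LinearMap.rTensor_comp]
      rfl
    refine Eq.trans ?_ ((h1 (V.ρ (e w))).trans ((congrArg _ h2).trans (h3 _).symm))
    have h4 : (TensorProduct.rid L V).symm (e w) = e w ⊗ₜ[L] (1 : L) := by simp
    change (V.tensor (character hχ)).ρ ((TensorProduct.rid L V).symm (e w)) = _
    rw [h4]
    rfl

/-- A product of characters equal to `1` trivializes the tensor product. -/
noncomputable def piCharacterIso {ι : Type} [Fintype ι] {χ : ι → H} (hχ : ∀ i, IsGroupLikeElem L (χ i))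
    (h : ∏ i, χ i = 1) : (piTensor fun i => character (hχ i)).Iso (trivial L H) where
  toLinearEquiv := (PiTensorProduct.constantBaseRingEquiv ι L).toLinearEquiv
  comm := by
    refine PiTensorProduct.ext (MultilinearMap.ext fun x => ?_)
    have h1 : (piTensor fun i => character (hχ i)).ρ (PiTensorProduct.tprod L x) =
        PiTensorProduct.tprod L x ⊗ₜ[L] 1 := by
      rw [← h, ← piMulRight_tprod]
      change piMulRight _ _ (PiTensorProduct.map _ _) = _
      rw [PiTensorProduct.map_tprod]
      rfl
    change _ ⊗ₜ[L] (1 : H) = LinearMap.rTensor H _ ((piTensor fun i => character (hχ i)).ρ _)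
    rw [h1]
    rfl

end GRep

/-! ### Representations with image `SL(n)` and their twists -/

namespace GRep

open Matrix GLn

variable {L : Type u} {H : Type v} [Field L] [CommRing H] [HopfAlgebra L H]

section ImageSL

variable {n : ℕ} {V : GRep L H} {b : Module.Basis (Fin n) L V}

theorem det_coeffMatrix_of_imageIdeal (h : V.imageIdeal b = idealSL L n) :
    (V.coeffMatrix b).det = 1 := by
  have h1 : algebraMap (MvPolynomial (Fin n × Fin n) L) (Coord L n) (genericDet L n) - 1 ∈
      V.imageIdeal b := by
    rw [h]
    exact Ideal.subset_span rfl
  have h2 : V.toGL b _ = 0 := h1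
  rw [map_sub, map_one, toGL, point_genericDet, sub_eq_zero] at h2
  exact h2

theorem pointSL_coeffMatrix_injective (h : V.imageIdeal b = idealSL L n) :
    Function.Injective (pointSL (L := L) (V.coeffMatrix b) (det_coeffMatrix_of_imageIdeal h)) := by
  rw [injective_iff_map_eq_zero]
  intro x hx
  obtain ⟨y, rfl⟩ := Ideal.Quotient.mk_surjective x
  refine Ideal.Quotient.eq_zero_iff_mem.2 ?_
  rw [← h]
  exact hx

theorem pointSL_mem_imageCoord (h : (V.coeffMatrix b).det = 1) (x : CoordSL L n) :
    pointSL (V.coeffMatrix b) h x ∈ V.imageCoord b := by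
  obtain ⟨y, rfl⟩ := Ideal.Quotient.mk_surjective x
  exact ⟨y, rfl⟩

/-- If the representations `V i` have image `SL(n)` and are jointly surjective, every family of
matrices of determinant `1` over `L` is a specialization of the matrices of coefficients. -/
theorem exists_specialization {ι : Type} [Fintype ι] {V : ι → GRep L H}
    {b : ∀ i, Module.Basis (Fin n) L (V i)} (hSL : ∀ i, (V i).imageIdeal (b i) = idealSL L n)
    (hsurj : JointlySurjective V b) (g : ι → Matrix (Fin n) (Fin n) L) (hg : ∀ i, (g i).det = 1) :
    ∃ l : H →ₗ[L] L, ∀ x : ι → CoordSL L n,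
      l (∏ i, pointSL ((V i).coeffMatrix (b i)) (det_coeffMatrix_of_imageIdeal (hSL i)) (x i)) =
        ∏ i, pointSL (g i) (hg i) (x i) := by
  choose r hr using fun i => LinearMap.exists_leftInverse_of_injective
    (pointSL (L := L) ((V i).coeffMatrix (b i)) (det_coeffMatrix_of_imageIdeal (hSL i))).toLinearMap
    (LinearMap.ker_eq_bot.2 (pointSL_coeffMatrix_injective (hSL i)))
  obtain ⟨R, hR⟩ := LinearMap.exists_leftInverse_of_injective (toProdImages V b)
    (LinearMap.ker_eq_bot.2 hsurj)
  let ev : (⨂[L] i, (V i).imageCoord (b i)) →ₗ[L] L :=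
    PiTensorProduct.lift ((MultilinearMap.mkPiAlgebra L ι L).compLinearMap
      fun i => (pointSL (L := L) (g i) (hg i)).toLinearMap ∘ₗ r i ∘ₗ
        ((V i).imageCoord (b i)).val.toLinearMap)
  refine ⟨ev ∘ₗ R, fun x => ?_⟩
  have h1 : toProdImages V b (PiTensorProduct.tprod L fun i =>
      ⟨_, pointSL_mem_imageCoord (det_coeffMatrix_of_imageIdeal (hSL i)) (x i)⟩) =
      ∏ i, pointSL ((V i).coeffMatrix (b i)) (det_coeffMatrix_of_imageIdeal (hSL i)) (x i) := by
    simp [toProdImages]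
  rw [← h1, LinearMap.comp_apply, ← LinearMap.comp_apply R, hR, LinearMap.id_apply]
  have h2 : ∀ i, r i (pointSL ((V i).coeffMatrix (b i)) (det_coeffMatrix_of_imageIdeal (hSL i))
      (x i)) = x i := fun i => LinearMap.congr_fun (hr i) (x i)
  simp [ev, h2]

end ImageSL

/-- Base change for matrices of coefficients. -/
theorem exists_basis_coeffMatrix {n : ℕ} (V : GRep L H) (b : Module.Basis (Fin n) L V)
    {f : Matrix (Fin n) (Fin n) L} (hf : IsUnit f.det) :
    ∃ b' : Module.Basis (Fin n) L V, V.coeffMatrix b * f.map (algebraMap L H) =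
      f.map (algebraMap L H) * V.coeffMatrix b' := by
  refine ⟨b.map (Matrix.toLinearEquiv b f hf), ?_⟩
  have h := (coaction_comm_iff (b.map (Matrix.toLinearEquiv b f hf)) b
    (V.ρ_basis _) (V.ρ_basis _) LinearMap.id).1 (by simp)
  have hid : LinearMap.toMatrix (b.map (Matrix.toLinearEquiv b f hf)) b LinearMap.id = f := by
    ext i j
    rw [LinearMap.toMatrix_apply, LinearMap.id_apply, Module.Basis.map_apply]
    change b.repr (Matrix.toLin b b f (b j)) i = f i j
    rw [Matrix.toLin_self]
    simp [Finsupp.single_apply]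
  rwa [hid] at h

section Twist

variable {V W : GRep L H} {b : Module.Basis (Fin 2) L V} {c : Module.Basis (Fin 2) L W}
  {f : Matrix (Fin 2) (Fin 2) L} {χ : H}

/-- In a suitable basis of `V` the matrix of the twist `W` is `χ` times that of `V`. -/
theorem exists_basis_of_twist (hf : IsUnit f.det)
    (h : f.map (algebraMap L H) * W.coeffMatrix c =
      χ • (V.coeffMatrix b * f.map (algebraMap L H))) :
    ∃ b' : Module.Basis (Fin 2) L V, V.coeffMatrix b * f.map (algebraMap L H) =
      f.map (algebraMap L H) * V.coeffMatrix b' ∧ W.coeffMatrix c = χ • V.coeffMatrix b' := by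
  obtain ⟨b', hb'⟩ := exists_basis_coeffMatrix V b hf
  refine ⟨b', hb', ?_⟩
  have hu : IsUnit (f.map (algebraMap L H)) :=
    ((isUnit_iff_isUnit_det f).2 hf).map (algebraMap L H).mapMatrix
  apply hu.mul_left_cancel
  rw [h, hb', mul_smul_comm]

theorem det_coeffMatrix_of_conj {b' : Module.Basis (Fin 2) L V} (hf : IsUnit f.det)
    (hb : (V.coeffMatrix b).det = 1) (h : V.coeffMatrix b * f.map (algebraMap L H) =
      f.map (algebraMap L H) * V.coeffMatrix b') : (V.coeffMatrix b').det = 1 := by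
  have hu : IsUnit (f.map (algebraMap L H)).det :=
    (isUnit_iff_isUnit_det _).1
      (((isUnit_iff_isUnit_det f).2 hf).map (algebraMap L H).mapMatrix)
  have h1 := congrArg Matrix.det h
  rw [det_mul, det_mul, hb, one_mul] at h1
  exact (hu.mul_left_cancel (by rw [← h1, mul_one])).symm

theorem isGroupLikeElem_of_twist (hb : (V.coeffMatrix b).det = 1) (hf : IsUnit f.det)
    (h : f.map (algebraMap L H) * W.coeffMatrix c =
      χ • (V.coeffMatrix b * f.map (algebraMap L H))) : IsGroupLikeElem L χ := by
  obtain ⟨b', hb', hχ⟩ := exists_basis_of_twist hf h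
  exact isGroupLikeElem_of_smul (det_coeffMatrix_of_conj hf hb hb') (comul_coeffMatrix V b')
    (counit_coeffMatrix V b') (comul_coeffMatrix W c) (counit_coeffMatrix W c) hχ

/-- If `W` is isomorphic to the twist of `V` by a character and the image of `V` is `SL(2)`, then the
image of `W` is `GL(2)` or `SL(2) · μ_k`. -/
theorem imageIdeal_of_twist (hSL : V.imageIdeal b = idealSL L 2) (hf : IsUnit f.det)
    (h : f.map (algebraMap L H) * W.coeffMatrix c =
      χ • (V.coeffMatrix b * f.map (algebraMap L H))) :
    W.imageIdeal c = ⊥ ∨ ∃ k : ℕ, 0 < k ∧ W.imageIdeal c = idealSLMu L 2 k := by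
  have hb := det_coeffMatrix_of_imageIdeal hSL
  have hgl := isGroupLikeElem_of_twist hb hf h
  obtain ⟨b', hb', hχ⟩ := exists_basis_of_twist hf h
  have hdet := det_coeffMatrix_of_conj hf hb hb'
  have hff : f⁻¹.map (algebraMap L H) * f.map (algebraMap L H) = 1 := by
    rw [← Matrix.map_mul, nonsing_inv_mul _ hf, Matrix.map_one _ (map_zero _) (map_one _)]
  have hinj := pointSL_injective_of_conj (mul_nonsing_inv _ hf) hb hdet
    (by rw [mul_assoc, hb', ← mul_assoc, hff, one_mul]) (pointSL_coeffMatrix_injective hSL)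
  obtain ⟨t, rfl⟩ := hgl.isUnit
  have key : W.imageIdeal c = idealSLMu L 2 (orderOf t) := by
    rw [← ker_point_smul hdet (comul_coeffMatrix V b') (counit_coeffMatrix V b') hinj t hgl]
    have : ∀ (a : Matrix (Fin 2) (Fin 2) H) (ha : IsUnit a.det),
        a = (t : H) • V.coeffMatrix b' → RingHom.ker (point (L := L) a ha) =
          RingHom.ker (point (L := L) ((t : H) • V.coeffMatrix b') (isUnit_det_smul hdet t)) := by
      rintro _ _ rfl
      rfl
    exact this _ _ hχ
  rcases Nat.eq_zero_or_pos (orderOf t) with h0 | h0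
  · left
    rw [key, h0, idealSLMu_zero]
  · exact Or.inr ⟨_, h0, key⟩

/-- The isomorphism onto a twist given by a matrix. -/
theorem exists_iso_of_twist (hf : IsUnit f.det) (hχ : IsGroupLikeElem L χ)
    (h : f.map (algebraMap L H) * W.coeffMatrix c =
      χ • (V.coeffMatrix b * f.map (algebraMap L H))) :
    ∃ φ : W.Iso (V.tensor (character hχ)), ∀ w, φ.toLinearEquiv w =
      Matrix.toLin c b f w ⊗ₜ[L] (1 : L) := by
  have h1 : f⁻¹ * f = 1 := nonsing_inv_mul _ hf
  have h2 : f * f⁻¹ = 1 := mul_nonsing_inv _ hf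
  let e : W ≃ₗ[L] V := Matrix.toLinOfInv c b h2 h1
  have he : e.toLinearMap = Matrix.toLin c b f := rfl
  refine ⟨isoTensorCharacter hχ e ?_, fun w => ?_⟩
  · refine (coaction_comm_iff c b (a' := χ • V.coeffMatrix b) (W.ρ_basis c) (fun j => ?_) _).2 ?_
    · rw [LinearMap.comp_apply, V.ρ_basis b, map_sum]
      refine Finset.sum_congr rfl fun i _ => ?_
      rw [LinearMap.lTensor_tmul, LinearMap.mulRight_apply, Matrix.smul_apply, smul_eq_mul, mul_comm]
    · rw [he, LinearMap.toMatrix_toLin, smul_mul_assoc, h]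
  · change (TensorProduct.rid L V).symm (e w) = _
    rw [TensorProduct.rid_symm_apply]
    rfl

end Twist

theorem tensorOfFactors_tprod {ι : Type} [Fintype ι] {W V N : ι → GRep L H} (s : Equiv.Perm ι)
    (τ : (piTensor N).Iso (trivial L H)) (φ : ∀ i, (W i).Iso ((V (s i)).tensor (N i)))
    (x : ∀ i, W i) (y : ∀ i, V (s i)) (z : ∀ i, N i)
    (h : ∀ i, (φ i).toLinearEquiv (x i) = y i ⊗ₜ[L] z i) {t : L}
    (ht : τ.toLinearEquiv (PiTensorProduct.tprod L z) = t) :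
    tensorOfFactors s τ φ (PiTensorProduct.tprod L x) =
      t • (PiTensorProduct.reindex L (fun i => (V i : Type u)) s.symm).symm
          (PiTensorProduct.tprod L y) := by
  have h1 : PiTensorProduct.congr (fun i => (φ i).toLinearEquiv) (PiTensorProduct.tprod L x) =
      PiTensorProduct.tprod L fun i => y i ⊗ₜ[L] z i := by
    refine (PiTensorProduct.congr_tprod _ _).trans ?_
    congr 1
    exact funext h
  change TensorProduct.rid L (⨂[L] i, V i) (TensorProduct.congr
    (PiTensorProduct.reindex L (fun i => (V i : Type u)) s.symm).symm τ.toLinearEquiv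
      (PiDistrib.equiv (fun i => (V (s i) : Type u)) (fun i => (N i : Type u))
        (PiTensorProduct.congr (fun i => (φ i).toLinearEquiv) (PiTensorProduct.tprod L x)))) = _
  rw [h1, PiDistrib.equiv_tprod]
  refine (congrArg _ (TensorProduct.congr_tmul _ _ _ _)).trans ?_
  rw [ht]
  exact TensorProduct.rid_tmul _ _

end GRep

theorem mainTheorem3 {L : Type u} [Field L] [CharZero L] {H : Type v} [CommRing H]
    [HopfAlgebra L H] (m : ℕ) (W V : Fin (m + 1) → GRep L H)
    (bW : ∀ i, Module.Basis (Fin 2) L (W i)) (bV : ∀ i, Module.Basis (Fin 2) L (V i))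
    (hSL : ∀ i, (V i).imageIdeal (bV i) = GLn.idealSL L 2)
    (hsurj : GRep.JointlySurjective V bV)
    (F : (GRep.piTensor W).Iso (GRep.piTensor V)) :
    (∀ i, (W i).imageIdeal (bW i) = ⊥ ∨
      ∃ k : ℕ, 0 < k ∧ (W i).imageIdeal (bW i) = GLn.idealSLMu L 2 k) ∧
    ∃ (s : Equiv.Perm (Fin (m + 1))) (N : Fin (m + 1) → GRep L H)
      (τ : (GRep.piTensor N).Iso (GRep.trivial L H))
      (φ : ∀ i, (W i).Iso ((V (s i)).tensor (N i))),
      (∀ i, Module.finrank L (N i) = 1) ∧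
      F.toLinearEquiv = GRep.tensorOfFactors s τ φ := by
  have hv := fun i => GRep.det_coeffMatrix_of_imageIdeal (hSL i)
  let B := Basis.piTensorProduct bW
  let C := Basis.piTensorProduct bV
  let F' : (⨂[L] i, W i) ≃ₗ[L] (⨂[L] i, V i) := F.toLinearEquiv
  let Φ := LinearMap.toMatrix B C F'.toLinearMap
  have hΦ : IsUnit Φ := by
    refine IsUnit.of_mul_eq_one (LinearMap.toMatrix C B F'.symm.toLinearMap) ?_
    rw [← LinearMap.toMatrix_comp C B C]
    simp
  have hcomm := (GRep.coaction_comm_iff B C (GRep.piTensor_ρ_basis W bW)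
    (GRep.piTensor_ρ_basis V bV) F'.toLinearMap).1 F.comm
  obtain ⟨s, f, χ, hf, hΦf, hχ, hχ1⟩ := exists_factorization hv
    (fun i => (W i).isUnit_det_coeffMatrix (bW i)) hΦ hcomm fun g hg => by
      obtain ⟨l, hl⟩ := GRep.exists_specialization hSL hsurj g hg
      refine ⟨l, fun p q p' q' => ?_⟩
      have h := hl fun i => GLn.genericSL L 2 (p i) (q i) *
        (GLn.genericSL L 2).adjugate (p' i) (q' i)
      simp only [map_mul, GLn.pointSL_generic, GLn.pointSL_adjugate,
        Finset.prod_mul_distrib] at h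
      exact h
  have hgl := fun i => GRep.isGroupLikeElem_of_twist (hv (s i)) (hf i) (hχ i)
  refine ⟨fun i => GRep.imageIdeal_of_twist (hSL (s i)) (hf i) (hχ i), s,
    fun i => GRep.character (hgl i), GRep.piCharacterIso hgl hχ1, ?_⟩
  choose φ hφ using fun i => GRep.exists_iso_of_twist (hf i) (hgl i) (hχ i)
  refine ⟨φ, fun i => Module.finrank_self L, ?_⟩
  apply LinearEquiv.toLinearMap_injective
  -- Both sides are compared on the basis vector `⨂ bW i (q i)`, after reindexing the target along `s`.
  refine B.ext fun q => ?_
  have hB : B q = PiTensorProduct.tprod L fun i => bW i (q i) := Basis.piTensorProduct_apply _ _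
  have hone : (GRep.piCharacterIso hgl hχ1).toLinearEquiv
      (PiTensorProduct.tprod L fun _ => (1 : L)) = (1 : L) := by
    change PiTensorProduct.constantBaseRingEquiv (Fin (m + 1)) L
      (PiTensorProduct.tprod L fun _ => (1 : L)) = 1
    rw [PiTensorProduct.constantBaseRingEquiv_tprod, Finset.prod_const_one]
  have hR := GRep.tensorOfFactors_tprod s (GRep.piCharacterIso hgl hχ1) φ (fun i => bW i (q i))
    _ _ (fun i => hφ i (bW i (q i))) hone
  rw [one_smul, ← hB] at hR
  have hL : F' (B q) = ∑ p, Φ p q • C p := by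
    simp [Φ, LinearMap.toMatrix_apply, C.sum_repr]
  refine Eq.trans ?_ hR.symm
  refine hL.trans ?_
  rw [LinearEquiv.eq_symm_apply, map_sum]
  simp only [map_smul]
  have hC : ∀ p, PiTensorProduct.reindex L (fun i => (V i : Type u)) s.symm (C p) =
      PiTensorProduct.tprod L fun i => bV (s i) (p (s i)) := fun p => by
    rw [Basis.piTensorProduct_apply]
    exact PiTensorProduct.reindex_tprod _ _
  simp only [hC, Matrix.toLin_self]
  rw [MultilinearMap.map_sum]
  refine Fintype.sum_equiv (Equiv.arrowCongr s.symm (Equiv.refl (Fin 2))) _ _ fun p => ?_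
  rw [MultilinearMap.map_smul_univ, hΦf]
  rfl
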